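/- Consider the equation $$-u''=\lambda u \quad\text{on }(-1,1),\qquad u\in C^2[-1,1],\ \lambda\in\mathbb R, \tag{1}$$ with the multi-point boundary conditions $$\alpha_0^\pm u(\pm1)+\beta_0^\pm u'(\pm1)=\sum_{i=1}^{m^\pm}\alpha_i^\pm u(\eta_i^\pm)+\sum_{i=1}^{m^\pm}\beta_i^\pm u'(\eta_i^\pm), \tag{2}$$ where $m^\pm\ge1$ are integers, all coefficients are real, $\eta_i^\pm\in[-1,1]$, $\eta_i^\pm\ne\pm1$, $\alpha_0^\pm\ge0$, $\alpha_0^\pm+|\beta_0^\pm|>0$ and $\pm\beta_0^\pm\ge0$. Suppose that, at both end points, $$\frac{\sum_{i=1}^{m^\pm}|\alpha_i^\pm|}{\alpha_0^\pm}+\frac{\sum_{i=1}^{m^\pm}|\beta_i^\pm|}{|\beta_0^\pm|}<1,$$ with the convention that if a denominator is zero then the corresponding numerator must also be zero and the fraction is omitted. For an integer $k\ge0$ let $S_k^+$ be the set of $u\in C^2[-1,1]$ such that $u(\pm1)\neq0$, $u(-1)>0$, and $u$ has only simple zeros in $(-1,1)$ and exactly $k$ of them; let $T_k^+$ be the set of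 $u\in C^2[-1,1]$ such that $u'(\pm1)\ne0$, $u'(-1)>0$, $u'$ has only simple zeros in $(-1,1)$ and exactly $k$ of them, and $u$ has a zero strictly between any two consecutive zeros of $u'$ in $(-1,1)$. Put $S_k=S_k^+\cup(-S_k^+)$ and $T_k=T_k^+\cup(-T_k^+)$. Let $\lambda_0^N<\lambda_1^N<\cdots$ and $\lambda_0^D<\lambda_1^D<\cdots$ be the eigenvalues of (1) with Neumann conditions $u'(\pm1)=0$ and with Dirichlet conditions $u(\pm1)=0$, respectively. Let $J^\pm=(\alpha_0^\pm/\beta_0^\pm)^2$ (with $J^\pm=\infty$ if $\beta_0^\pm=0$), and $$k_T=\max\{k\ge0:\lambda_k^N\le\min\{J^-,J^+\}\},\qquad k_S=\min\{k\ge0:\lambda_k^D\ge\max\{J^-,J^+\}\},$$ where $k_T=\infty$ if $\min\{J^-,J^+\}=\infty$, and $k_S=\infty$ if $\max\{J^-,J^+\}=\infty$. Then the set of real eigenvalues of (1)-(2) can be listed as a strictly increasing sequence $\lambda_0<\lambda_1<\cdots$, and for every integer $k\ge0$: - if $k\le k_T-2$, then every eigenfunction $\psi_k$ of $\lambda_k$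 belongs to $T_{k+1}$, and $\lambda_k^N<\lambda_k<\lambda_{k+2}^N$; - if $k\ge k_S+2$, then every eigenfunction $\psi_k$ of $\lambda_k$ belongs to $S_k$, and $\lambda_{k-2}^D<\lambda_k<\lambda_k^D$. -/

import Mathlib

open scoped BigOperators

noncomputable section

namespace MultiPoint

/-- The closed interval `[-1,1]`. -/
def I : Set ℝ := Set.Icc (-1) 1

/-- The derivative on `[-1,1]` (one-sided at the end points). -/
def D (u : ℝ → ℝ) : ℝ → ℝ := derivWithin u I

/-- `u` (restricted to `[-1,1]`) belongs to `C²[-1,1]`. -/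
def IsC2 (u : ℝ → ℝ) : Prop := ContDiffOn ℝ 2 u I

/-- `u ∈ C²[-1,1]` is a non-trivial solution of `-u'' = lam * u` on `(-1,1)` satisfying the
boundary conditions `B`. -/
def IsEigenfunction (B : (ℝ → ℝ) → Prop) (lam : ℝ) (u : ℝ → ℝ) : Prop :=
  IsC2 u ∧ (∀ x ∈ Set.Ioo (-1 : ℝ) 1, -D (D u) x = lam * u x) ∧ B u ∧ ∃ x ∈ I, u x ≠ 0

/-- The set of (real) eigenvalues of `-u'' = lam * u` with the boundary conditions `B`. -/
def eigenvalues (B : (ℝ → ℝ) → Prop) : Set ℝ := {lam | ∃ u, IsEigenfunction B lam u}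

/-- `l 0 < l 1 < l 2 < ⋯` is the increasing enumeration of the set `σ`
(it is determined by `σ`). -/
def Enumerates (l : ℕ → ℝ) (σ : Set ℝ) : Prop := StrictMono l ∧ Set.range l = σ

/-- Dirichlet conditions at both end points. -/
def Dirichlet (u : ℝ → ℝ) : Prop := u (-1) = 0 ∧ u 1 = 0

/-- Neumann conditions at both end points. -/
def Neumann (u : ℝ → ℝ) : Prop := D u (-1) = 0 ∧ D u 1 = 0

/-- The coefficients of a multi-point boundary condition at one end point. -/
structure EndCondition where
  m : ℕ
  α₀ : ℝ
  β₀ : ℝ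
  α : Fin m → ℝ
  β : Fin m → ℝ
  η : Fin m → ℝ

namespace EndCondition

/-- The boundary condition with coefficients `c` at the end point `e` (`e = -1` or `e = 1`):
`α₀ u(e) + β₀ u'(e) = ∑ αᵢ u(ηᵢ) + ∑ βᵢ u'(ηᵢ)`. -/
def Holds (c : EndCondition) (e : ℝ) (u : ℝ → ℝ) : Prop :=
  c.α₀ * u e + c.β₀ * D u e = ∑ i, c.α i * u (c.η i) + ∑ i, c.β i * D u (c.η i)

/-- The standing assumptions on the coefficients at the end point `e`
(`e = -1` or `e = 1`). -/
structure Standing (c : EndCondition) (e : ℝ) : Prop where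
  m_pos : 1 ≤ c.m
  η_mem : ∀ i, c.η i ∈ I
  η_ne : ∀ i, c.η i ≠ e
  α₀_nonneg : 0 ≤ c.α₀
  nontrivial : 0 < c.α₀ + |c.β₀|
  β₀_sign : 0 ≤ e * c.β₀

/-- `(∑ |αᵢ|) / α₀ + (∑ |βᵢ|) / |β₀| < 1`, where a zero denominator requires the numerator to
vanish, and the fraction is then omitted. -/
structure LinCond (c : EndCondition) : Prop where
  α_zero : c.α₀ = 0 → ∑ i, |c.α i| = 0
  β_zero : c.β₀ = 0 → ∑ i, |c.β i| = 0
  lt_one : (∑ i, |c.α i|) / c.α₀ + (∑ i, |c.β i|) / |c.β₀| < 1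

/-- `J = (α₀ / β₀)²`, with `J = ∞` if `β₀ = 0`. -/
def J (c : EndCondition) : EReal :=
  if c.β₀ = 0 then ⊤ else (((c.α₀ / c.β₀) ^ 2 : ℝ) : EReal)

end EndCondition

/-- The multi-point conditions with coefficients `cm` at `-1` and `cp` at `1`. -/
def MultiPointBC (cm cp : EndCondition) (u : ℝ → ℝ) : Prop :=
  cm.Holds (-1) u ∧ cp.Holds 1 u

/-- `max {k : l k ≤ min J⁻ J⁺}`, which is `∞` if the set contains every `k`;
`l` is to be the sequence of Neumann eigenvalues. -/
def kT (cm cp : EndCondition) (l : ℕ → ℝ) : ℕ∞ :=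
  sSup {n : ℕ∞ | ∃ k : ℕ, n = (k : ℕ∞) ∧ ((l k : ℝ) : EReal) ≤ min cm.J cp.J}

/-- `min {k : l k ≥ max J⁻ J⁺}`, which is `∞` if the set is empty;
`l` is to be the sequence of Dirichlet eigenvalues. -/
def kS (cm cp : EndCondition) (l : ℕ → ℝ) : ℕ∞ :=
  sInf {n : ℕ∞ | ∃ k : ℕ, n = (k : ℕ∞) ∧ max cm.J cp.J ≤ ((l k : ℝ) : EReal)}

/-- The nodal set `S_k⁺`. -/
def SPlus (k : ℕ) : Set (ℝ → ℝ) :=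
  {u | IsC2 u ∧ u (-1) ≠ 0 ∧ u 1 ≠ 0 ∧ 0 < u (-1) ∧
    (∀ x ∈ Set.Ioo (-1 : ℝ) 1, u x = 0 → D u x ≠ 0) ∧
    {x ∈ Set.Ioo (-1 : ℝ) 1 | u x = 0}.encard = k}

/-- The nodal set `S_k = S_k⁺ ∪ (-S_k⁺)`. -/
def S (k : ℕ) : Set (ℝ → ℝ) := {u | u ∈ SPlus k ∨ -u ∈ SPlus k}

/-- The nodal set `T_k⁺`. -/
def TPlus (k : ℕ) : Set (ℝ → ℝ) :=
  {u | IsC2 u ∧ D u (-1) ≠ 0 ∧ D u 1 ≠ 0 ∧ 0 < D u (-1) ∧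
    (∀ x ∈ Set.Ioo (-1 : ℝ) 1, D u x = 0 → D (D u) x ≠ 0) ∧
    {x ∈ Set.Ioo (-1 : ℝ) 1 | D u x = 0}.encard = k ∧
    ∀ x ∈ Set.Ioo (-1 : ℝ) 1, ∀ y ∈ Set.Ioo (-1 : ℝ) 1, x < y → D u x = 0 → D u y = 0 →
      (∀ z ∈ Set.Ioo x y, D u z ≠ 0) → ∃ z ∈ Set.Ioo x y, u z = 0}

/-- The nodal set `T_k = T_k⁺ ∪ (-T_k⁺)`. -/
def T (k : ℕ) : Set (ℝ → ℝ) := {u | u ∈ TPlus k ∨ -u ∈ TPlus k}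

end MultiPoint

end

noncomputable section

namespace MultiPoint

/-! The proof is a Prüfer-type phase argument. For `lam = s ^ 2 > 0` every solution is `A * sin (s *
(x + 1) + φ)`. A multi-point condition is linear in `(sin φ, cos φ)`, so it fixes `φ` modulo `π`, to
a value `phase` depending on `s`. Matching the two ends, with the right end treated by reflection,
shows that `s ^ 2` is an eigenvalue exactly when `totalPhase = 2 * s + phase⁻ + phase⁺` is a
multiple of `π`.

Everything rests on `one_add_deriv_phase_pos`: `s + phase` is strictly increasing at each end.
Differentiating the boundary condition implicitly reduces this to an inequality between the
end-point terms and the interior sums, which the linear smallness condition supplies through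
`sum_abs_sq_add_sq_le`, `weighted_sq_lt` and `nonneg_of_balance`. Hence each multiple of `π` is
attained at most once. By continuity and the limit at `0+`, the multiples attained start at `π`, or
at `2 * π` when `0` is itself an eigenvalue; a convexity argument excludes negative eigenvalues. So
the `k`-th root solves `totalPhase = (k + 1) * π`.

The thresholds `J` locate the phase: it lies in `(-π/2, π/2)` when `s ^ 2 ≤ J` and in `(0, π)` when
`s ^ 2 ≥ J`. Evaluating `totalPhase` at Neumann or Dirichlet roots then gives the eigenvalue bounds,
and the phases at the two ends give the zero counts. -/

theorem uniqueDiffOn_I : UniqueDiffOn ℝ I := uniqueDiffOn_Icc (by norm_num)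

theorem Ioo_subset_I : Set.Ioo (-1 : ℝ) 1 ⊆ I := Set.Ioo_subset_Icc_self

theorem I_mem_nhds {x : ℝ} (hx : x ∈ Set.Ioo (-1 : ℝ) 1) : I ∈ nhds x := Icc_mem_nhds hx.1 hx.2

theorem D_eq_of_hasDerivAt {u : ℝ → ℝ} {d x : ℝ} (hx : x ∈ I) (h : HasDerivAt u d x) :
    D u x = d :=
  h.hasDerivWithinAt.derivWithin (uniqueDiffOn_I x hx)

theorem D_congr {u v : ℝ → ℝ} (h : ∀ x ∈ I, u x = v x) {x : ℝ} (hx : x ∈ I) : D u x = D v x :=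
  derivWithin_congr h (h x hx)

theorem D_neg (u : ℝ → ℝ) : D (-u) = -D u := by
  funext x
  simp [D, derivWithin.neg]

theorem IsC2.contDiffOn_D {u : ℝ → ℝ} (h : IsC2 u) : ContDiffOn ℝ 1 (D u) I :=
  h.derivWithin uniqueDiffOn_I (by norm_num)

theorem IsC2.neg {u : ℝ → ℝ} (h : IsC2 u) : IsC2 (-u) := ContDiffOn.neg h

theorem IsC2.hasDerivAt {u : ℝ → ℝ} (h : IsC2 u) {x : ℝ} (hx : x ∈ Set.Ioo (-1 : ℝ) 1) :
    HasDerivAt u (D u x) x :=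
  ((h.differentiableOn (by norm_num)) x (Ioo_subset_I hx)).hasDerivWithinAt.hasDerivAt
    (I_mem_nhds hx)

theorem IsC2.hasDerivAt_D {u : ℝ → ℝ} (h : IsC2 u) {x : ℝ} (hx : x ∈ Set.Ioo (-1 : ℝ) 1) :
    HasDerivAt (D u) (D (D u) x) x :=
  ((h.contDiffOn_D.differentiableOn (by norm_num)) x
    (Ioo_subset_I hx)).hasDerivWithinAt.hasDerivAt (I_mem_nhds hx)

theorem IsC2.continuousOn {u : ℝ → ℝ} (h : IsC2 u) : ContinuousOn u I := ContDiffOn.continuousOn h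

theorem IsC2.continuousOn_D {u : ℝ → ℝ} (h : IsC2 u) : ContinuousOn (D u) I :=
  h.contDiffOn_D.continuousOn

theorem monotoneOn_I {f f' : ℝ → ℝ} (hc : ContinuousOn f I)
    (hd : ∀ x ∈ Set.Ioo (-1 : ℝ) 1, HasDerivAt f (f' x) x)
    (h0 : ∀ x ∈ Set.Ioo (-1 : ℝ) 1, 0 ≤ f' x) : MonotoneOn f I := by
  refine monotoneOn_of_deriv_nonneg (convex_Icc _ _) hc ?_ ?_
  · rw [interior_Icc]
    exact fun x hx => (hd x hx).differentiableAt.differentiableWithinAt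
  · rw [interior_Icc]
    intro x hx
    rw [(hd x hx).deriv]
    exact h0 x hx

theorem eq_left_of_hasDerivAt_zero {f : ℝ → ℝ} (hc : ContinuousOn f I)
    (hd : ∀ x ∈ Set.Ioo (-1 : ℝ) 1, HasDerivAt f 0 x) : ∀ x ∈ I, f x = f (-1) := by
  intro x hx
  have hl : (-1 : ℝ) ∈ I := by norm_num [I]
  have h1 := monotoneOn_I hc hd (fun _ _ => le_rfl) hl hx hx.1
  have h2 := monotoneOn_I hc.neg (fun x hx => (hd x hx).neg) (fun _ _ => by simp) hl hx hx.1
  exact le_antisymm (neg_le_neg_iff.1 h2) h1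

/-! ### Solutions of the differential equation -/

namespace IsEigenfunction

variable {B : (ℝ → ℝ) → Prop} {lam : ℝ} {u : ℝ → ℝ}

theorem hasDerivAt_D (h : IsEigenfunction B lam u) {x : ℝ} (hx : x ∈ Set.Ioo (-1 : ℝ) 1) :
    HasDerivAt (D u) (-(lam * u x)) x := by
  have := h.1.hasDerivAt_D hx
  rwa [← h.2.1 x hx, neg_neg]

/-- Conservation of energy. -/
theorem energy (h : IsEigenfunction B lam u) :
    ∀ x ∈ I, D u x ^ 2 + lam * u x ^ 2 = D u (-1) ^ 2 + lam * u (-1) ^ 2 := by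
  refine eq_left_of_hasDerivAt_zero (f := fun x => D u x ^ 2 + lam * u x ^ 2) ?_ ?_
  · exact (h.1.continuousOn_D.pow 2).add (continuousOn_const.mul (h.1.continuousOn.pow 2))
  · intro x hx
    refine HasDerivAt.congr_deriv (((h.hasDerivAt_D hx).pow 2).add (((h.1.hasDerivAt hx).pow 2).const_mul lam)) ?_
    simp
    ring

/-- The vector `(s * u, u')` rotates with angular speed `s`; undoing the rotation gives two
conserved quantities, and polar coordinates of the initial data give amplitude and phase. -/
theorem exists_sin {s : ℝ} (hs : 0 < s) (h : IsEigenfunction B (s ^ 2) u) :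
    ∃ A φ : ℝ, A ≠ 0 ∧ ∀ x ∈ I, u x = A * Real.sin (s * (x + 1) + φ) ∧
      D u x = A * s * Real.cos (s * (x + 1) + φ) := by
  have hlin : ∀ x, HasDerivAt (fun x : ℝ => s * (x + 1)) s x := fun x => by
    simpa using ((hasDerivAt_id x).add_const 1).const_mul s
  have hcc : ContinuousOn (fun x : ℝ => Real.cos (s * (x + 1))) I := by fun_prop
  have hsc : ContinuousOn (fun x : ℝ => Real.sin (s * (x + 1))) I := by fun_prop
  have h1 := eq_left_of_hasDerivAt_zero
    (f := fun x => s * u x * Real.cos (s * (x + 1)) - D u x * Real.sin (s * (x + 1)))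
    (((continuousOn_const.mul h.1.continuousOn).mul hcc).sub (h.1.continuousOn_D.mul hsc))
    (fun x hx => by
      refine HasDerivAt.congr_deriv ((((h.1.hasDerivAt hx).const_mul s).mul (hlin x).cos).sub
        ((h.hasDerivAt_D hx).mul (hlin x).sin)) ?_
      ring)
  have h2 := eq_left_of_hasDerivAt_zero
    (f := fun x => s * u x * Real.sin (s * (x + 1)) + D u x * Real.cos (s * (x + 1)))
    (((continuousOn_const.mul h.1.continuousOn).mul hsc).add (h.1.continuousOn_D.mul hcc))
    (fun x hx => by
      refine HasDerivAt.congr_deriv ((((h.1.hasDerivAt hx).const_mul s).mul (hlin x).sin).add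
        ((h.hasDerivAt_D hx).mul (hlin x).cos)) ?_
      ring)
  simp only [neg_add_cancel, mul_zero, Real.cos_zero, Real.sin_zero, mul_one, sub_zero,
    zero_add] at h1 h2
  set z : ℂ := ⟨D u (-1) / s, u (-1)⟩
  have hz1 : ‖z‖ * Real.cos z.arg = D u (-1) / s := Complex.norm_mul_cos_arg z
  have hz2 : ‖z‖ * Real.sin z.arg = u (-1) := Complex.norm_mul_sin_arg z
  have hz1' : ‖z‖ * Real.cos z.arg * s = D u (-1) := by rw [hz1]; field_simp
  have key : ∀ x ∈ I, u x = ‖z‖ * Real.sin (s * (x + 1) + z.arg) ∧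
      D u x = ‖z‖ * s * Real.cos (s * (x + 1) + z.arg) := by
    intro x hx
    have e1 := h1 x hx
    have e2 := h2 x hx
    have e3 := Real.sin_sq_add_cos_sq (s * (x + 1))
    rw [Real.sin_add, Real.cos_add]
    constructor
    · apply mul_left_cancel₀ hs.ne'
      linear_combination Real.cos (s * (x + 1)) * e1 + Real.sin (s * (x + 1)) * e2 -
        s * u x * e3 - s * Real.cos (s * (x + 1)) * hz2 - Real.sin (s * (x + 1)) * hz1'
    · linear_combination Real.cos (s * (x + 1)) * e2 - Real.sin (s * (x + 1)) * e1 -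
        D u x * e3 + s * Real.sin (s * (x + 1)) * hz2 - Real.cos (s * (x + 1)) * hz1'
  refine ⟨‖z‖, z.arg, fun h0 => ?_, key⟩
  obtain ⟨x, hx, hux⟩ := h.2.2.2
  exact hux (by rw [(key x hx).1, h0, zero_mul])

/-- For `lam ≤ 0` the square of an eigenfunction and the square of its derivative are maximal at
an end point, where `u` does not move towards `0`. -/
theorem exists_endpoint_max (h : IsEigenfunction B lam u) (hlam : lam ≤ 0) :
    ∃ e : ℝ, (e = -1 ∨ e = 1) ∧ 0 ≤ e * (u e * D u e) ∧
      ∀ x ∈ I, |u x| ≤ |u e| ∧ |D u x| ≤ |D u e| := by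
  have hl : (-1 : ℝ) ∈ I := by norm_num [I]
  have hr : (1 : ℝ) ∈ I := by norm_num [I]
  have hmono : MonotoneOn (fun x => u x * D u x) I := by
    refine monotoneOn_I (f' := fun x => D u x ^ 2 - lam * u x ^ 2)
      (h.1.continuousOn.mul h.1.continuousOn_D) (fun x hx => ?_) (fun x _ => ?_)
    · refine HasDerivAt.congr_deriv ((h.1.hasDerivAt hx).mul (h.hasDerivAt_D hx)) ?_
      ring
    · nlinarith [sq_nonneg (D u x), mul_nonneg (neg_nonneg.2 hlam) (sq_nonneg (u x))]
  have hsq : ∀ x ∈ Set.Ioo (-1 : ℝ) 1, HasDerivAt (fun x => u x ^ 2) (2 * (u x * D u x)) x := by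
    intro x hx
    refine HasDerivAt.congr_deriv ((h.1.hasDerivAt hx).pow 2) ?_
    simp
    ring
  have hderiv : ∀ e ∈ I, ∀ x ∈ I, |u x| ≤ |u e| → |D u x| ≤ |D u e| := by
    intro e he x hx hle
    rw [← sq_le_sq] at hle ⊢
    nlinarith [h.energy e he, h.energy x hx, mul_le_mul_of_nonneg_left hle (neg_nonneg.2 hlam)]
  have hconv : ConvexOn ℝ I (fun x => u x ^ 2) := by
    refine MonotoneOn.convexOn_of_deriv (convex_Icc _ _) (h.1.continuousOn.pow 2) ?_ ?_
    · rw [interior_Icc]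
      exact fun x hx => (hsq x hx).differentiableAt.differentiableWithinAt
    · rw [interior_Icc]
      intro x hx y hy hxy
      rw [(hsq x hx).deriv, (hsq y hy).deriv]
      have := hmono (Ioo_subset_I hx) (Ioo_subset_I hy) hxy
      simp only at this
      linarith
  have hmax : ∀ x ∈ I, u x ^ 2 ≤ max (u (-1) ^ 2) (u 1 ^ 2) := fun x hx =>
    hconv.le_max_of_mem_Icc hl hr hx
  rcases le_total (u (-1) ^ 2) (u 1 ^ 2) with hle | hle
  · have hb : ∀ x ∈ I, |u x| ≤ |u 1| := fun x hx => by
      rw [← sq_le_sq]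
      simpa [hle] using hmax x hx
    by_cases h0 : 0 ≤ u 1 * D u 1
    · exact ⟨1, Or.inr rfl, by linarith, fun x hx => ⟨hb x hx, hderiv 1 hr x hx (hb x hx)⟩⟩
    -- If `u * u'` is negative at `1`, monotonicity makes it nonpositive throughout, so `u ^ 2`
    -- decreases and `-1` is a maximum with the right sign.
    push Not at h0
    have hanti : MonotoneOn (fun x => -(u x ^ 2)) I :=
      monotoneOn_I (h.1.continuousOn.pow 2).neg (fun x hx => (hsq x hx).neg) (fun x hx => by
        have := hmono (Ioo_subset_I hx) hr hx.2.le
        simp only at this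
        linarith)
    have h1 := hanti hl hr (by norm_num)
    simp only [neg_le_neg_iff] at h1
    have hl1 := hmono hl hr (by norm_num)
    simp only at hl1
    refine ⟨-1, Or.inl rfl, by linarith, fun x hx => ?_⟩
    have : |u x| ≤ |u (-1)| := (hb x hx).trans (sq_le_sq.1 h1)
    exact ⟨this, hderiv _ hl x hx this⟩
  · have hb : ∀ x ∈ I, |u x| ≤ |u (-1)| := fun x hx => by
      rw [← sq_le_sq]
      simpa [hle] using hmax x hx
    by_cases h0 : 0 ≤ -1 * (u (-1) * D u (-1))
    · exact ⟨-1, Or.inl rfl, h0, fun x hx => ⟨hb x hx, hderiv _ hl x hx (hb x hx)⟩⟩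
    push Not at h0
    have hm : MonotoneOn (fun x => u x ^ 2) I :=
      monotoneOn_I (h.1.continuousOn.pow 2) hsq (fun x hx => by
        have := hmono hl (Ioo_subset_I hx) hx.1.le
        simp only at this
        linarith)
    have h1 := hm hl hr (by norm_num)
    simp only at h1
    have hl1 := hmono hl hr (by norm_num)
    simp only at hl1
    refine ⟨1, Or.inr rfl, by linarith, fun x hx => ?_⟩
    have : |u x| ≤ |u 1| := (hb x hx).trans (sq_le_sq.1 h1)
    exact ⟨this, hderiv _ hr x hx this⟩

end IsEigenfunction

theorem D_sin {A s φ x : ℝ} (hx : x ∈ I) :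
    D (fun x => A * Real.sin (s * (x + 1) + φ)) x = A * s * Real.cos (s * (x + 1) + φ) := by
  apply D_eq_of_hasDerivAt hx
  refine HasDerivAt.congr_deriv (((((hasDerivAt_id x).add_const 1).const_mul s).add_const φ).sin.const_mul A) ?_
  simp
  ring

theorem D_cos {A s φ x : ℝ} (hx : x ∈ I) :
    D (fun x => A * Real.cos (s * (x + 1) + φ)) x = -(A * s * Real.sin (s * (x + 1) + φ)) := by
  apply D_eq_of_hasDerivAt hx
  refine HasDerivAt.congr_deriv (((((hasDerivAt_id x).add_const 1).const_mul s).add_const φ).cos.const_mul A) ?_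
  simp
  ring

theorem isEigenfunction_sin {B : (ℝ → ℝ) → Prop} {s φ : ℝ} (hs : 0 < s)
    (hB : B (fun x => 1 * Real.sin (s * (x + 1) + φ))) :
    IsEigenfunction B (s ^ 2) (fun x => 1 * Real.sin (s * (x + 1) + φ)) := by
  have hC2 : IsC2 (fun x => 1 * Real.sin (s * (x + 1) + φ)) :=
    ContDiff.contDiffOn (by fun_prop)
  refine ⟨hC2, fun x hx => ?_, hB, ?_⟩
  · rw [D_congr (fun y hy => D_sin hy) (Ioo_subset_I hx), D_cos (Ioo_subset_I hx)]
    ring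
  · by_contra! hne
    have h0 := hne (-1) (by norm_num [I])
    have h1 : D (fun x => 1 * Real.sin (s * (x + 1) + φ)) (-1) = D (fun _ => 0) (-1) :=
      D_congr hne (by norm_num [I])
    rw [D_sin (by norm_num [I]), D_eq_of_hasDerivAt (by norm_num [I]) (hasDerivAt_const _ _)] at h1
    simp [hs.ne'] at h0 h1
    have := Real.sin_sq_add_cos_sq φ
    rw [h0, h1] at this
    norm_num at this

/-! ### Inequalities behind the monotonicity of the phase -/

theorem weighted_sq_lt {a b X Y : ℝ} (ha : 0 ≤ a) (hb : 0 ≤ b) (hab : a + b < 1) (hX : 0 ≤ X)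
    (hY : 0 ≤ Y) (hXY : 0 < X + Y) : (a * X + b * Y) ^ 2 < X ^ 2 + Y ^ 2 := by
  rcases le_total X Y with h | h
  · have h1 : a * X + b * Y < Y := by nlinarith
    have h2 : 0 ≤ a * X + b * Y := by positivity
    nlinarith
  · have h1 : a * X + b * Y < X := by nlinarith
    have h2 : 0 ≤ a * X + b * Y := by positivity
    nlinarith

/-- Used with `x = cos φ`, `y = sin φ`, where `hbal` is the boundary condition. If the conclusion
failed, `Y * x + B = X * y - A` would be negative, forcing `x < b` and `y < a`. Then `x` and `y`
cannot both be positive, and combining `hbal` with `hpos` contradicts `a * |y| + b * |x| ≤ 1`. -/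
theorem nonneg_of_balance {a b X Y x y A B : ℝ} (ha : 0 ≤ a) (hb : 0 ≤ b) (hab : a + b < 1)
    (hX : 0 ≤ X) (hY : 0 ≤ Y) (hxy : y ^ 2 + x ^ 2 = 1) (hbal : X * y - Y * x = A + B)
    (hpos : 0 < X * x + Y * y) (hA : |A| ≤ a * X) (hB : |B| ≤ b * Y) : 0 ≤ Y * x + B := by
  by_contra! hneg
  obtain ⟨hA1, hA2⟩ := abs_le.1 hA
  obtain ⟨hB1, hB2⟩ := abs_le.1 hB
  have hxb : x < b := by
    by_contra! h
    nlinarith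
  have hya : y < a := by
    by_contra! h
    nlinarith
  have hx1 : x ≤ 1 := by nlinarith [sq_nonneg y]
  have hx2 : -1 ≤ x := by nlinarith [sq_nonneg y]
  have hy1 : y ≤ 1 := by nlinarith [sq_nonneg x]
  have hy2 : -1 ≤ y := by nlinarith [sq_nonneg x]
  rcases le_or_gt x 0 with hx | hx
  · have hy : 0 < y := by
      by_contra! h
      nlinarith [mul_nonneg hX (neg_nonneg.2 hx), mul_nonneg hY (neg_nonneg.2 h)]
    have h1 : Y * (-x - b) ≤ X * (a - y) := by linarith
    have h2 : Y * (-x - b) * y ≤ X * (a - y) * y := by nlinarith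
    have h3 : X * (-x) < Y * y := by linarith
    have h4 : Y * (-x - b) * (-x) ≤ X * (-x) * (a - y) := by nlinarith
    have h5 : X * (-x) * (a - y) < Y * y * (a - y) := by nlinarith
    have h6 : Y * 1 < Y * (a * y + b * (-x)) := by
      have : Y * (y ^ 2 + x ^ 2) = Y * 1 := by rw [hxy]
      linarith
    have h7 : a * y + b * (-x) ≤ 1 := by nlinarith
    nlinarith
  · have hy : y ≤ 0 := by
      by_contra! h
      nlinarith
    have h1 : X * (-y - a) ≤ Y * (b - x) := by linarith
    have h3 : Y * (-y) < X * x := by linarith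
    have h4 : X * (-y - a) * (-y) ≤ Y * (-y) * (b - x) := by nlinarith
    have h5 : Y * (-y) * (b - x) < X * x * (b - x) := by nlinarith
    have h6 : X * 1 < X * (a * (-y) + b * x) := by
      have : X * (y ^ 2 + x ^ 2) = X * 1 := by rw [hxy]
      linarith
    have h7 : a * (-y) + b * x ≤ 1 := by nlinarith
    nlinarith

/-- The triangle inequality in `ℂ`: the two sums are the real and imaginary parts of a combination
of unit vectors with weights `|α i|` and `s * |β i|`. -/
theorem sum_abs_sq_add_sq_le {ι : Type*} [Fintype ι] {s : ℝ} (hs : 0 ≤ s) (α β t : ι → ℝ) :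
    (∑ i, |α i| * |Real.cos (t i)| + s * ∑ i, |β i| * |Real.sin (t i)|) ^ 2 +
      (∑ i, |α i| * |Real.sin (t i)| + s * ∑ i, |β i| * |Real.cos (t i)|) ^ 2 ≤
      (∑ i, |α i| + s * ∑ i, |β i|) ^ 2 := by
  have hunit : ∀ x y : ℝ, x ^ 2 + y ^ 2 = 1 → ‖(⟨|x|, |y|⟩ : ℂ)‖ = 1 := by
    intro x y h
    rw [Complex.norm_def, Complex.normSq_mk, abs_mul_abs_self, abs_mul_abs_self,
      show x * x + y * y = 1 by linarith, Real.sqrt_one]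
  set z : ℂ := ∑ i, ((|α i| : ℝ) : ℂ) * ⟨|Real.cos (t i)|, |Real.sin (t i)|⟩ +
    (s : ℂ) * ∑ i, ((|β i| : ℝ) : ℂ) * ⟨|Real.sin (t i)|, |Real.cos (t i)|⟩
  have hz : ‖z‖ ≤ ∑ i, |α i| + s * ∑ i, |β i| := by
    refine (norm_add_le _ _).trans (add_le_add ?_ ?_)
    · refine norm_sum_le_of_le _ fun i _ => ?_
      rw [norm_mul, hunit _ _ (Real.cos_sq_add_sin_sq _)]
      simp
    · rw [norm_mul, Complex.norm_real, Real.norm_eq_abs, abs_of_nonneg hs]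
      refine mul_le_mul_of_nonneg_left (norm_sum_le_of_le _ fun i _ => ?_) hs
      rw [norm_mul, hunit _ _ (Real.sin_sq_add_cos_sq _)]
      simp
  have hre : z.re = ∑ i, |α i| * |Real.cos (t i)| + s * ∑ i, |β i| * |Real.sin (t i)| := by
    simp [z]
  have him : z.im = ∑ i, |α i| * |Real.sin (t i)| + s * ∑ i, |β i| * |Real.cos (t i)| := by
    simp [z]
  have := pow_le_pow_left₀ (norm_nonneg z) hz 2
  rw [Complex.sq_norm, Complex.normSq_apply, hre, him] at this
  linarith

/-! ### A boundary condition as a phase -/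

namespace EndCondition

/-- The defect of the boundary condition `c` at `e` for `u x = sin (s * (1 - e * x) + φ)`. -/
def defect (c : EndCondition) (e s φ : ℝ) : ℝ :=
  c.α₀ * Real.sin φ - s * (e * c.β₀) * Real.cos φ -
    ∑ i, c.α i * Real.sin (s * (1 - e * c.η i) + φ) +
    s * ∑ i, e * c.β i * Real.cos (s * (1 - e * c.η i) + φ)

/-- The complex number whose argument is the phase at `e` of the solutions of `-u'' = s ^ 2 * u`
that satisfy the boundary condition `c`. -/
def phaseVec (c : EndCondition) (e s : ℝ) : ℂ :=
  ⟨c.defect e s (Real.pi / 2), -c.defect e s 0⟩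

/-- The phase at `e` of the solutions of `-u'' = s ^ 2 * u` that satisfy the boundary
condition `c`. -/
def phase (c : EndCondition) (e s : ℝ) : ℝ := (c.phaseVec e s).arg

theorem defect_pi_div_two (c : EndCondition) (e s : ℝ) :
    c.defect e s (Real.pi / 2) = c.α₀ - ∑ i, c.α i * Real.cos (s * (1 - e * c.η i)) -
      s * ∑ i, e * c.β i * Real.sin (s * (1 - e * c.η i)) := by
  simp [defect, Real.sin_add_pi_div_two, Real.cos_add_pi_div_two]
  ring

theorem defect_zero (c : EndCondition) (e s : ℝ) :
    c.defect e s 0 = -(s * (e * c.β₀)) - ∑ i, c.α i * Real.sin (s * (1 - e * c.η i)) +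
      s * ∑ i, e * c.β i * Real.cos (s * (1 - e * c.η i)) := by
  simp [defect]

theorem defect_eq (c : EndCondition) (e s φ : ℝ) :
    c.defect e s φ =
      c.defect e s (Real.pi / 2) * Real.sin φ + c.defect e s 0 * Real.cos φ := by
  rw [defect_pi_div_two, defect_zero, defect]
  simp only [Real.sin_add, Real.cos_add, mul_add, mul_sub, Finset.sum_add_distrib,
    Finset.sum_sub_distrib, ← mul_assoc, ← Finset.sum_mul]
  ring

theorem defect_eq_norm_mul_sin (c : EndCondition) (e s φ : ℝ) :
    c.defect e s φ = ‖c.phaseVec e s‖ * Real.sin (φ - c.phase e s) := by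
  have h1 : ‖c.phaseVec e s‖ * Real.cos (c.phase e s) = c.defect e s (Real.pi / 2) :=
    Complex.norm_mul_cos_arg _
  have h2 : ‖c.phaseVec e s‖ * Real.sin (c.phase e s) = -c.defect e s 0 :=
    Complex.norm_mul_sin_arg _
  rw [defect_eq, Real.sin_sub]
  linear_combination -Real.sin φ * h1 + Real.cos φ * h2

theorem holds_iff_defect {c : EndCondition} {e s φ A : ℝ} {u : ℝ → ℝ} (he : e = -1 ∨ e = 1)
    (hη : ∀ i, c.η i ∈ I) (hA : A ≠ 0)
    (hu : ∀ x ∈ I, u x = A * Real.sin (s * (1 - e * x) + φ) ∧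
      D u x = -(e * A * s * Real.cos (s * (1 - e * x) + φ))) :
    c.Holds e u ↔ c.defect e s φ = 0 := by
  have he2 : e * e = 1 := by rcases he with rfl | rfl <;> norm_num
  have heI : e ∈ I := by rcases he with rfl | rfl <;> norm_num [I]
  have h1 : ∑ i, c.α i * u (c.η i) = A * ∑ i, c.α i * Real.sin (s * (1 - e * c.η i) + φ) := by
    rw [Finset.mul_sum]
    exact Finset.sum_congr rfl fun i _ => by rw [(hu _ (hη i)).1]; ring
  have h2 : ∑ i, c.β i * D u (c.η i) =
      -(A * (s * ∑ i, e * c.β i * Real.cos (s * (1 - e * c.η i) + φ))) := by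
    rw [Finset.mul_sum, Finset.mul_sum, ← Finset.sum_neg_distrib]
    exact Finset.sum_congr rfl fun i _ => by rw [(hu _ (hη i)).2]; ring
  rw [Holds, h1, h2, (hu e heI).1, (hu e heI).2, he2, sub_self, mul_zero, zero_add,
    ← mul_eq_zero_iff_left hA (b := c.defect e s φ), defect, ← sub_eq_zero]
  refine Eq.congr_left ?_
  ring

/-- The standing assumptions and the smallness condition in multiplied-out form. -/
structure Small (c : EndCondition) (e a b : ℝ) : Prop where
  end_eq : e = -1 ∨ e = 1
  η_mem : ∀ i, c.η i ∈ I
  a_nonneg : 0 ≤ a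
  b_nonneg : 0 ≤ b
  add_lt_one : a + b < 1
  α₀_nonneg : 0 ≤ c.α₀
  β₀_nonneg : 0 ≤ e * c.β₀
  nontrivial : 0 < c.α₀ + e * c.β₀
  α_le : ∑ i, |c.α i| ≤ a * c.α₀
  β_le : ∑ i, |c.β i| ≤ b * (e * c.β₀)

/-- The constants are the two fractions of the hypothesis; division by zero yields `0`, which agrees
with omitting a fraction. -/
theorem Standing.exists_small {c : EndCondition} {e : ℝ} (he : e = -1 ∨ e = 1)
    (h : c.Standing e) (hl : c.LinCond) : ∃ a b, c.Small e a b := by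
  have habs : |c.β₀| = e * c.β₀ := by
    rw [← abs_of_nonneg h.β₀_sign, abs_mul]
    rcases he with rfl | rfl <;> simp
  refine ⟨(∑ i, |c.α i|) / c.α₀, (∑ i, |c.β i|) / |c.β₀|, he, h.η_mem, ?_, ?_, hl.lt_one,
    h.α₀_nonneg, h.β₀_sign, ?_, ?_, ?_⟩
  · exact div_nonneg (Finset.sum_nonneg fun _ _ => abs_nonneg _) h.α₀_nonneg
  · exact div_nonneg (Finset.sum_nonneg fun _ _ => abs_nonneg _) (abs_nonneg _)
  · rw [← habs]
    exact h.nontrivial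
  · rcases eq_or_ne c.α₀ 0 with h0 | h0
    · rw [hl.α_zero h0, h0, mul_zero]
    · rw [div_mul_cancel₀ _ h0]
  · rw [← habs]
    rcases eq_or_ne c.β₀ 0 with h0 | h0
    · rw [hl.β_zero h0, h0, abs_zero, mul_zero]
    · rw [div_mul_cancel₀ _ (abs_ne_zero.2 h0)]

namespace Small

variable {c : EndCondition} {e a b s : ℝ}

theorem sq_eq_one (h : c.Small e a b) : e * e = 1 := by
  rcases h.end_eq with rfl | rfl <;> norm_num

theorem abs_e (h : c.Small e a b) : |e| = 1 := by
  rcases h.end_eq with rfl | rfl <;> norm_num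

theorem abs_mul_η_le_one (h : c.Small e a b) (i : Fin c.m) : |e * c.η i| ≤ 1 := by
  rw [abs_mul, h.abs_e, one_mul]
  exact abs_le.2 (h.η_mem i)

theorem abs_sum_sin_le (_ : c.Small e a b) (t : Fin c.m → ℝ) :
    |∑ i, c.α i * Real.sin (t i)| ≤ ∑ i, |c.α i| * |Real.sin (t i)| :=
  (Finset.abs_sum_le_sum_abs _ _).trans (Finset.sum_le_sum fun _ _ => (abs_mul _ _).le)

theorem abs_sum_cos_le (_ : c.Small e a b) (t : Fin c.m → ℝ) :
    |∑ i, c.α i * Real.cos (t i)| ≤ ∑ i, |c.α i| * |Real.cos (t i)| :=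
  (Finset.abs_sum_le_sum_abs _ _).trans (Finset.sum_le_sum fun _ _ => (abs_mul _ _).le)

theorem abs_sum_mul_sin_le (h : c.Small e a b) (t : Fin c.m → ℝ) :
    |∑ i, e * c.β i * Real.sin (t i)| ≤ ∑ i, |c.β i| * |Real.sin (t i)| :=
  (Finset.abs_sum_le_sum_abs _ _).trans
    (Finset.sum_le_sum fun i _ => by rw [abs_mul, abs_mul, h.abs_e, one_mul])

theorem abs_sum_mul_cos_le (h : c.Small e a b) (t : Fin c.m → ℝ) :
    |∑ i, e * c.β i * Real.cos (t i)| ≤ ∑ i, |c.β i| * |Real.cos (t i)| :=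
  (Finset.abs_sum_le_sum_abs _ _).trans
    (Finset.sum_le_sum fun i _ => by rw [abs_mul, abs_mul, h.abs_e, one_mul])

theorem sum_α_sin_le (h : c.Small e a b) (t : Fin c.m → ℝ) :
    ∑ i, |c.α i| * |Real.sin (t i)| ≤ a * c.α₀ :=
  (Finset.sum_le_sum fun _ _ => mul_le_of_le_one_right (abs_nonneg _)
    (Real.abs_sin_le_one _)).trans h.α_le

theorem sum_α_cos_le (h : c.Small e a b) (t : Fin c.m → ℝ) :
    ∑ i, |c.α i| * |Real.cos (t i)| ≤ a * c.α₀ :=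
  (Finset.sum_le_sum fun _ _ => mul_le_of_le_one_right (abs_nonneg _)
    (Real.abs_cos_le_one _)).trans h.α_le

theorem sum_β_sin_le (h : c.Small e a b) (t : Fin c.m → ℝ) :
    ∑ i, |c.β i| * |Real.sin (t i)| ≤ b * (e * c.β₀) :=
  (Finset.sum_le_sum fun _ _ => mul_le_of_le_one_right (abs_nonneg _)
    (Real.abs_sin_le_one _)).trans h.β_le

theorem sum_β_cos_le (h : c.Small e a b) (t : Fin c.m → ℝ) :
    ∑ i, |c.β i| * |Real.cos (t i)| ≤ b * (e * c.β₀) :=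
  (Finset.sum_le_sum fun _ _ => mul_le_of_le_one_right (abs_nonneg _)
    (Real.abs_cos_le_one _)).trans h.β_le

/-- When `α₀` dominates `s * |β₀|`, the interior sums amount to at most `(a + b) * α₀`. The next
lemma is the mirror case; together they keep `phaseVec` off the cut of `arg`. -/
theorem defect_pi_div_two_pos (h : c.Small e a b) (hs : 0 ≤ s) (h0 : 0 < c.α₀)
    (hle : s * (e * c.β₀) ≤ c.α₀) : 0 < c.defect e s (Real.pi / 2) := by
  rw [defect_pi_div_two]
  have h1 := (le_abs_self _).trans ((h.abs_sum_cos_le fun i => s * (1 - e * c.η i)).trans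
    (h.sum_α_cos_le _))
  have h2 := (le_abs_self _).trans ((h.abs_sum_mul_sin_le fun i => s * (1 - e * c.η i)).trans
    (h.sum_β_sin_le _))
  have h3 := mul_le_mul_of_nonneg_left h2 hs
  have h4 := mul_le_mul_of_nonneg_left hle h.b_nonneg
  nlinarith [h.add_lt_one]

theorem defect_zero_neg (h : c.Small e a b) (hs : 0 < s)
    (hle : c.α₀ ≤ s * (e * c.β₀)) : c.defect e s 0 < 0 := by
  have hpos : 0 < s * (e * c.β₀) := by
    rcases h.β₀_nonneg.eq_or_lt with h0 | h0
    · have := h.nontrivial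
      rw [← h0] at this hle
      linarith
    · positivity
  rw [defect_zero]
  have h1 := (neg_le_abs _).trans ((h.abs_sum_sin_le fun i => s * (1 - e * c.η i)).trans
    (h.sum_α_sin_le _))
  have h2 := (le_abs_self _).trans ((h.abs_sum_mul_cos_le fun i => s * (1 - e * c.η i)).trans
    (h.sum_β_cos_le _))
  have h3 := mul_le_mul_of_nonneg_left h2 hs.le
  have h4 := mul_le_mul_of_nonneg_left hle h.a_nonneg
  nlinarith [h.add_lt_one]

theorem phaseVec_mem_slitPlane (h : c.Small e a b) (hs : 0 < s) :
    c.phaseVec e s ∈ Complex.slitPlane := by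
  rcases le_or_gt c.α₀ (s * (e * c.β₀)) with hle | hlt
  · exact Or.inr (neg_ne_zero.2 (h.defect_zero_neg hs hle).ne)
  · exact Or.inl (h.defect_pi_div_two_pos hs.le
      ((mul_nonneg hs.le h.β₀_nonneg).trans_lt hlt) hlt.le)

theorem abs_phase_lt (h : c.Small e a b) (hs : 0 ≤ s) (h0 : 0 < c.α₀)
    (hle : s * (e * c.β₀) ≤ c.α₀) : |c.phase e s| < Real.pi / 2 :=
  Complex.abs_arg_lt_pi_div_two_iff.2 (Or.inl (h.defect_pi_div_two_pos hs h0 hle))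

theorem phase_mem_Ioo (h : c.Small e a b) (hs : 0 < s) (hle : c.α₀ ≤ s * (e * c.β₀)) :
    c.phase e s ∈ Set.Ioo 0 Real.pi := by
  have him : 0 < (c.phaseVec e s).im := neg_pos.2 (h.defect_zero_neg hs hle)
  have hlt : c.phase e s < Real.pi := lt_of_le_of_ne (Complex.arg_le_pi _) fun hpi => by
    have := (Complex.arg_eq_pi_iff.1 hpi).2
    linarith
  refine ⟨lt_of_le_of_ne (Complex.arg_nonneg_iff.2 him.le) fun hz => ?_, hlt⟩
  have := (Complex.arg_eq_zero_iff.1 hz.symm).2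
  linarith

theorem neg_pi_div_two_lt_phase (h : c.Small e a b) (hs : 0 < s) :
    -(Real.pi / 2) < c.phase e s := by
  rcases le_or_gt c.α₀ (s * (e * c.β₀)) with hle | hlt
  · linarith [(h.phase_mem_Ioo hs hle).1, Real.pi_pos]
  · exact (abs_lt.1 (h.abs_phase_lt hs.le
      ((mul_nonneg hs.le h.β₀_nonneg).trans_lt hlt) hlt.le)).1

theorem phaseVec_ne_zero (h : c.Small e a b) (hs : 0 < s) : c.phaseVec e s ≠ 0 :=
  Complex.slitPlane_ne_zero (h.phaseVec_mem_slitPlane hs)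

theorem defect_eq_zero_iff (h : c.Small e a b) (hs : 0 < s) {φ : ℝ} :
    c.defect e s φ = 0 ↔ ∃ n : ℤ, n * Real.pi = φ - c.phase e s := by
  rw [defect_eq_norm_mul_sin, mul_eq_zero_iff_left (norm_ne_zero_iff.2 (h.phaseVec_ne_zero hs)),
    Real.sin_eq_zero_iff]

end Small

theorem differentiable_phaseVec (c : EndCondition) (e : ℝ) : Differentiable ℝ (c.phaseVec e) := by
  have h : c.phaseVec e = fun s => ((c.defect e s (Real.pi / 2) : ℝ) : ℂ) +
      ((-c.defect e s 0 : ℝ) : ℂ) * Complex.I := by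
    funext s
    rw [← Complex.mk_eq_add_mul_I]
    rfl
  have h1 : ∀ φ, Differentiable ℝ fun s => c.defect e s φ := by
    intro φ
    unfold defect
    fun_prop
  rw [h]
  exact ((Complex.ofRealCLM.differentiable.comp (h1 _))).add
    ((Complex.ofRealCLM.differentiable.comp (h1 _).neg).mul_const _)

namespace Small

variable {c : EndCondition} {e a b s : ℝ}

theorem differentiableAt_phase (h : c.Small e a b) (hs : 0 < s) :
    DifferentiableAt ℝ (c.phase e) s := by
  have h1 := ((c.differentiable_phaseVec e s).hasDerivAt.clog_real
    (h.phaseVec_mem_slitPlane hs)).differentiableAt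
  have h2 : c.phase e = fun t => (Complex.log (c.phaseVec e t)).im := by
    funext t
    rw [Complex.log_im, phase]
  rw [h2]
  exact Complex.imCLM.differentiableAt.comp s h1

theorem defect_phase (c : EndCondition) (e s : ℝ) : c.defect e s (c.phase e s) = 0 := by
  rw [defect_eq_norm_mul_sin, sub_self, Real.sin_zero, mul_zero]

theorem defect_phase_add_pi_div_two (c : EndCondition) (e s : ℝ) :
    c.defect e s (c.phase e s + Real.pi / 2) = ‖c.phaseVec e s‖ := by
  rw [defect_eq_norm_mul_sin, add_sub_cancel_left, Real.sin_pi_div_two, mul_one]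

end Small

/-- The value of the phase at `s = 0+`. -/
def phaseZero (c : EndCondition) : ℝ :=
  if c.α₀ = 0 then Real.pi / 2 else 0

/-! ### Monotonicity of the phase and its limit at zero -/

namespace Small

variable {c : EndCondition} {e a b s : ℝ}

theorem hasDerivAt_defect {φ : ℝ → ℝ} {φ' : ℝ} (c : EndCondition) (e : ℝ)
    (hφ : HasDerivAt φ φ' s) :
    HasDerivAt (fun t => c.defect e t (φ t))
      (φ' * c.defect e s (φ s + Real.pi / 2) + (-(e * c.β₀ * Real.cos (φ s)) -
        ∑ i, c.α i * ((1 - e * c.η i) * Real.cos (s * (1 - e * c.η i) + φ s)) +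
        ∑ i, e * c.β i * Real.cos (s * (1 - e * c.η i) + φ s) -
        s * ∑ i, e * c.β i * ((1 - e * c.η i) * Real.sin (s * (1 - e * c.η i) + φ s)))) s := by
  have hin : ∀ d : ℝ, HasDerivAt (fun t => t * d + φ t) (d + φ') s := fun d => by
    exact HasDerivAt.congr_deriv (((hasDerivAt_id s).mul_const d).add hφ) (by rw [one_mul])
  have h1 := hφ.sin.const_mul c.α₀
  have h2 := ((hasDerivAt_id s).mul_const (e * c.β₀)).mul hφ.cos
  have h3 := HasDerivAt.fun_sum (u := Finset.univ)
    (fun i _ => (hin (1 - e * c.η i)).sin.const_mul (c.α i))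
  have h4 := (hasDerivAt_id s).mul (HasDerivAt.fun_sum (u := Finset.univ)
    (fun i _ => (hin (1 - e * c.η i)).cos.const_mul (e * c.β i)))
  refine HasDerivAt.congr_deriv (((h1.sub h2).sub h3).add h4) ?_
  rw [defect]
  simp only [← add_assoc, Real.sin_add_pi_div_two, Real.cos_add_pi_div_two, id]
  have e1 : ∑ i, c.α i * (Real.cos (s * (1 - e * c.η i) + φ s) * (1 - e * c.η i + φ')) =
      ∑ i, c.α i * ((1 - e * c.η i) * Real.cos (s * (1 - e * c.η i) + φ s)) +
      φ' * ∑ i, c.α i * Real.cos (s * (1 - e * c.η i) + φ s) := by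
    rw [Finset.mul_sum, ← Finset.sum_add_distrib]
    exact Finset.sum_congr rfl fun i _ => by ring
  have e2 : ∑ i, e * c.β i * (-Real.sin (s * (1 - e * c.η i) + φ s) * (1 - e * c.η i + φ')) =
      -∑ i, e * c.β i * ((1 - e * c.η i) * Real.sin (s * (1 - e * c.η i) + φ s)) +
      φ' * ∑ i, e * c.β i * -Real.sin (s * (1 - e * c.η i) + φ s) := by
    rw [Finset.mul_sum, ← Finset.sum_neg_distrib, ← Finset.sum_add_distrib]
    exact Finset.sum_congr rfl fun i _ => by ring
  rw [e1, e2]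
  ring

/-- Differentiate `defect = 0` along the phase and let `N > 0` be the derivative of `defect` in `φ`.
Then `N * (1 + phase')` equals `K`, minus sums weighted by `e * η i` that are bounded by `C` since
`|η i| ≤ 1`, plus a remainder `e * β₀ * cos φ - ∑ e * β i * cos (t i)`. The remainder is nonnegative
by `nonneg_of_balance`, so `C < K` suffices. -/
theorem one_add_deriv_phase_pos (h : c.Small e a b) (hs : 0 < s) :
    0 < 1 + deriv (c.phase e) s := by
  have hd := hasDerivAt_defect c e (h.differentiableAt_phase hs).hasDerivAt
  have h0 := hd.unique ((hasDerivAt_const s (0 : ℝ)).congr_of_eventuallyEq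
    (Filter.Eventually.of_forall fun t => defect_phase c e t))
  have hN : 0 < c.defect e s (c.phase e s + Real.pi / 2) := by
    rw [defect_phase_add_pi_div_two]
    exact norm_pos_iff.2 (h.phaseVec_ne_zero hs)
  have hz := defect_phase c e s
  refine pos_of_mul_pos_right (a := c.defect e s (c.phase e s + Real.pi / 2)) ?_ hN.le
  set N := c.defect e s (c.phase e s + Real.pi / 2) with hNdef
  set φ := c.phase e s
  set t : Fin c.m → ℝ := fun i => s * (1 - e * c.η i) + φ with ht
  have hY : 0 ≤ s * (e * c.β₀) := mul_nonneg hs.le h.β₀_nonneg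
  have hφ := Real.sin_sq_add_cos_sq φ
  have hbal : c.α₀ * Real.sin φ - s * (e * c.β₀) * Real.cos φ =
      ∑ i, c.α i * Real.sin (t i) + -(s * ∑ i, e * c.β i * Real.cos (t i)) := by
    rw [defect] at hz
    linarith
  have hNeq : N = c.α₀ * Real.cos φ + s * (e * c.β₀) * Real.sin φ -
      ∑ i, c.α i * Real.cos (t i) - s * ∑ i, e * c.β i * Real.sin (t i) := by
    rw [hNdef, defect]
    simp only [← add_assoc, Real.sin_add_pi_div_two, Real.cos_add_pi_div_two, mul_neg,
      Finset.sum_neg_distrib, ht]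
    ring
  have hle1 := h.abs_sum_sin_le t
  have hle2 := mul_le_mul_of_nonneg_left (h.abs_sum_mul_cos_le t) hs.le
  have hle3 := h.abs_sum_cos_le t
  have hle4 := mul_le_mul_of_nonneg_left (h.abs_sum_mul_sin_le t) hs.le
  have habs : ∀ z, |(-(s * z))| = s * |z| := fun z => by rw [abs_neg, abs_mul, abs_of_pos hs]
  set C := ∑ i, |c.α i| * |Real.cos (t i)| + s * ∑ i, |c.β i| * |Real.sin (t i)| with hC
  set S := ∑ i, |c.α i| * |Real.sin (t i)| + s * ∑ i, |c.β i| * |Real.cos (t i)| with hS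
  set K := c.α₀ * Real.cos φ + s * (e * c.β₀) * Real.sin φ with hK
  have hC0 : 0 ≤ C := by
    refine add_nonneg (Finset.sum_nonneg fun _ _ => by positivity)
      (mul_nonneg hs.le (Finset.sum_nonneg fun _ _ => by positivity))
  have hCS : C ^ 2 + S ^ 2 ≤ (∑ i, |c.α i| + s * ∑ i, |c.β i|) ^ 2 :=
    sum_abs_sq_add_sq_le hs.le c.α c.β t
  have hsum0 : 0 ≤ ∑ i, |c.α i| + s * ∑ i, |c.β i| :=
    add_nonneg (Finset.sum_nonneg fun _ _ => abs_nonneg _)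
      (mul_nonneg hs.le (Finset.sum_nonneg fun _ _ => abs_nonneg _))
  have hsum : ∑ i, |c.α i| + s * ∑ i, |c.β i| ≤ a * c.α₀ + b * (s * (e * c.β₀)) := by
    have := mul_le_mul_of_nonneg_left h.β_le hs.le
    linarith [h.α_le]
  have hXY : 0 < c.α₀ + s * (e * c.β₀) := by
    rcases h.α₀_nonneg.eq_or_lt with h0 | h0
    · have := h.nontrivial
      rw [← h0, zero_add] at this ⊢
      positivity
    · linarith
  have hR := weighted_sq_lt h.a_nonneg h.b_nonneg h.add_lt_one h.α₀_nonneg hY hXY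
  have hR2 := pow_le_pow_left₀ hsum0 hsum 2
  have hbalS : (c.α₀ * Real.sin φ - s * (e * c.β₀) * Real.cos φ) ^ 2 ≤ S ^ 2 := by
    rw [hbal]
    refine sq_le_sq' ?_ ?_
    · have h1 := (abs_le.1 hle1).1
      have h2 := (abs_le.1 ((habs (∑ i, e * c.β i * Real.cos (t i))).le.trans hle2)).1
      linarith
    · have h1 := (abs_le.1 hle1).2
      have h2 := (abs_le.1 ((habs (∑ i, e * c.β i * Real.cos (t i))).le.trans hle2)).2
      linarith
  have hid : K ^ 2 + (c.α₀ * Real.sin φ - s * (e * c.β₀) * Real.cos φ) ^ 2 =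
      c.α₀ ^ 2 + (s * (e * c.β₀)) ^ 2 := by
    rw [hK]
    linear_combination (c.α₀ ^ 2 + (s * (e * c.β₀)) ^ 2) * hφ
  -- `K` and the left side of `hbal` are a rotation of `(α₀, s * e * β₀)`. The latter is at most `S`
  -- in modulus, while `C ^ 2 + S ^ 2` is below the squared length of that vector.
  have hKC2 : C ^ 2 < K ^ 2 := by linarith
  -- Positivity of `N` selects the sign of `K`.
  have hKC : -C < K := by
    have h1 := (abs_le.1 hle3).1
    have h2 := (abs_le.1 ((habs (∑ i, e * c.β i * Real.sin (t i))).le.trans hle4)).2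
    linarith
  have hCK : C < K := by
    by_contra! hcon
    nlinarith
  have hX := nonneg_of_balance h.a_nonneg h.b_nonneg h.add_lt_one h.α₀_nonneg hY hφ hbal
    (hC0.trans_lt hCK) (hle1.trans (h.sum_α_sin_le t)) (by
      rw [habs]
      refine hle2.trans ((mul_le_mul_of_nonneg_left (h.sum_β_cos_le t) hs.le).trans (le_of_eq ?_))
      ring)
  have hX' : 0 ≤ e * c.β₀ * Real.cos φ - ∑ i, e * c.β i * Real.cos (t i) := by
    refine (mul_nonneg_iff_of_pos_left hs).1 ?_
    linarith
  have hα : |∑ i, c.α i * (e * c.η i * Real.cos (t i))| ≤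
      ∑ i, |c.α i| * |Real.cos (t i)| := by
    refine (Finset.abs_sum_le_sum_abs _ _).trans (Finset.sum_le_sum fun i _ => ?_)
    rw [abs_mul, abs_mul]
    exact mul_le_mul_of_nonneg_left
      (mul_le_of_le_one_left (abs_nonneg _) (h.abs_mul_η_le_one i)) (abs_nonneg _)
  have hβ : |∑ i, e * c.β i * (e * c.η i * Real.sin (t i))| ≤
      ∑ i, |c.β i| * |Real.sin (t i)| := by
    refine (Finset.abs_sum_le_sum_abs _ _).trans (Finset.sum_le_sum fun i _ => ?_)
    rw [abs_mul, abs_mul e, h.abs_e, one_mul, abs_mul (e * c.η i)]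
    exact mul_le_mul_of_nonneg_left
      (mul_le_of_le_one_left (abs_nonneg _) (h.abs_mul_η_le_one i)) (abs_nonneg _)
  have hβ' := mul_le_mul_of_nonneg_left ((le_abs_self _).trans hβ) hs.le
  have e1 : ∑ i, c.α i * ((1 - e * c.η i) * Real.cos (t i)) =
      ∑ i, c.α i * Real.cos (t i) - ∑ i, c.α i * (e * c.η i * Real.cos (t i)) := by
    rw [← Finset.sum_sub_distrib]
    exact Finset.sum_congr rfl fun i _ => by ring
  have e2 : ∑ i, e * c.β i * ((1 - e * c.η i) * Real.sin (t i)) =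
      ∑ i, e * c.β i * Real.sin (t i) - ∑ i, e * c.β i * (e * c.η i * Real.sin (t i)) := by
    rw [← Finset.sum_sub_distrib]
    exact Finset.sum_congr rfl fun i _ => by ring
  rw [e1, e2] at h0
  have hα' := (le_abs_self _).trans hα
  linarith

/-- If `α₀ = 0`, every `α i` vanishes and `phaseVec` degenerates at `0`; dividing by `s` leaves the
argument unchanged and gives a limit on the positive imaginary axis. Otherwise `phaseVec` is a
positive real at `0`. -/
theorem tendsto_phase (h : c.Small e a b) :
    Filter.Tendsto (c.phase e) (nhdsWithin 0 (Set.Ioi 0)) (nhds c.phaseZero) := by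
  by_cases h0 : c.α₀ = 0
  · have hα : ∀ i, c.α i = 0 := fun i => by
      have h1 := h.α_le
      rw [h0, mul_zero] at h1
      exact abs_eq_zero.1 (le_antisymm ((Finset.single_le_sum (f := fun i => |c.α i|)
        (fun _ _ => abs_nonneg _) (Finset.mem_univ i)).trans h1) (abs_nonneg _))
    set z : ℝ → ℂ := fun s =>
      ((-∑ i, e * c.β i * Real.sin (s * (1 - e * c.η i)) : ℝ) : ℂ) +
      ((e * c.β₀ - ∑ i, e * c.β i * Real.cos (s * (1 - e * c.η i)) : ℝ) : ℂ) * Complex.I with hz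
    have hpos : 0 < e * c.β₀ - ∑ i, e * c.β i := by
      have h1 := h.abs_sum_mul_cos_le (fun _ => 0)
      have h2 := h.sum_β_cos_le (fun _ => 0)
      have h3 := h.nontrivial
      simp only [Real.cos_zero, mul_one] at h1 h2
      have h4 := le_abs_self (∑ i, e * c.β i)
      rw [h0] at h3
      nlinarith [h.a_nonneg, h.add_lt_one]
    have hz0 : z 0 = ((e * c.β₀ - ∑ i, e * c.β i : ℝ) : ℂ) * Complex.I := by
      simp [hz]
    have hcont : Continuous z := by fun_prop
    have harg : (z 0).arg = Real.pi / 2 := by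
      rw [hz0, Complex.arg_real_mul _ hpos, Complex.arg_I]
    have hslit : z 0 ∈ Complex.slitPlane := by
      rw [hz0]
      exact Or.inr (by simpa using hpos.ne')
    have hten : Filter.Tendsto (fun s => (z s).arg) (nhdsWithin 0 (Set.Ioi 0))
        (nhds c.phaseZero) := by
      rw [phaseZero, if_pos h0, ← harg]
      exact ((Complex.continuousAt_arg hslit).comp hcont.continuousAt).tendsto.mono_left
        nhdsWithin_le_nhds
    refine hten.congr' ?_
    filter_upwards [self_mem_nhdsWithin] with s hs
    rw [phase, ← Complex.arg_real_mul (z s) hs]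
    congr 1
    have hzs : z s = ⟨_, _⟩ := (Complex.mk_eq_add_mul_I _ _).symm
    rw [hzs, phaseVec, defect_pi_div_two, defect_zero]
    apply Complex.ext
    · rw [Complex.re_ofReal_mul]
      simp [hα, h0]
    · rw [Complex.im_ofReal_mul]
      simp [hα]
      ring
  · have hpos : 0 < c.α₀ := lt_of_le_of_ne h.α₀_nonneg (Ne.symm h0)
    have hre : 0 < c.defect e 0 (Real.pi / 2) :=
      h.defect_pi_div_two_pos le_rfl hpos (by rw [zero_mul]; exact h.α₀_nonneg)
    have hv : c.phaseVec e 0 = ((c.defect e 0 (Real.pi / 2) : ℝ) : ℂ) := by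
      apply Complex.ext
      · simp [phaseVec]
      · simp [phaseVec, defect_zero]
    have harg : c.phase e 0 = 0 := by
      rw [phase, hv, Complex.arg_ofReal_of_nonneg hre.le]
    have hc : ContinuousAt (c.phase e) 0 :=
      (Complex.continuousAt_arg (Or.inl (by rw [hv]; exact hre))).comp
        (c.differentiable_phaseVec e).continuous.continuousAt
    have hten := hc.tendsto
    rw [harg] at hten
    rw [phaseZero, if_neg h0]
    exact hten.mono_left nhdsWithin_le_nhds

theorem strictMonoOn_add_phase (h : c.Small e a b) :
    StrictMonoOn (fun s => s + c.phase e s) (Set.Ioi 0) := by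
  have hd : ∀ s ∈ Set.Ioi (0 : ℝ), HasDerivAt (fun s => s + c.phase e s)
      (1 + deriv (c.phase e) s) s := fun s hs =>
    (hasDerivAt_id s).add (h.differentiableAt_phase hs).hasDerivAt
  refine strictMonoOn_of_deriv_pos (convex_Ioi 0)
    (fun s hs => (hd s hs).continuousAt.continuousWithinAt) fun s hs => ?_
  rw [interior_Ioi] at hs
  rw [(hd s hs).deriv]
  exact h.one_add_deriv_phase_pos hs

theorem phaseZero_lt (h : c.Small e a b) (hs : 0 < s) : c.phaseZero < s + c.phase e s := by
  have hlim : Filter.Tendsto (fun s => s + c.phase e s) (nhdsWithin 0 (Set.Ioi 0))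
      (nhds c.phaseZero) := by
    simpa using (Filter.Tendsto.mono_left (f := fun s : ℝ => s) Filter.tendsto_id
      (nhdsWithin_le_nhds (a := (0 : ℝ)) (s := Set.Ioi 0))).add h.tendsto_phase
  have hhalf : 0 < s / 2 := by positivity
  have h1 : c.phaseZero ≤ s / 2 + c.phase e (s / 2) := by
    refine le_of_tendsto hlim ?_
    filter_upwards [Ioo_mem_nhdsGT hhalf] with t ht
    exact (h.strictMonoOn_add_phase ht.1 hhalf ht.2).le
  exact h1.trans_lt (h.strictMonoOn_add_phase hhalf hs (by linarith))

end Small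

end EndCondition

open EndCondition

/-! ### Positive eigenvalues through the total phase -/

/-- `s ^ 2` with `0 < s` is an eigenvalue if and only if this is an integer multiple of `π`. -/
def totalPhase (cm cp : EndCondition) (s : ℝ) : ℝ :=
  s + cm.phase (-1) s + (s + cp.phase 1 s)

variable {cm cp : EndCondition} {a b a' b' s : ℝ}

theorem strictMonoOn_totalPhase (hm : cm.Small (-1) a b) (hp : cp.Small 1 a' b') :
    StrictMonoOn (totalPhase cm cp) (Set.Ioi 0) := fun _ hx _ hy hxy =>
  add_lt_add (hm.strictMonoOn_add_phase hx hy hxy) (hp.strictMonoOn_add_phase hx hy hxy)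

theorem phaseZero_add_lt_totalPhase (hm : cm.Small (-1) a b) (hp : cp.Small 1 a' b')
    (hs : 0 < s) : cm.phaseZero + cp.phaseZero < totalPhase cm cp s :=
  add_lt_add (hm.phaseZero_lt hs) (hp.phaseZero_lt hs)

theorem exists_totalPhase_eq (hm : cm.Small (-1) a b) (hp : cp.Small 1 a' b') {y : ℝ}
    (hy : cm.phaseZero + cp.phaseZero < y) : ∃ s, 0 < s ∧ totalPhase cm cp s = y := by
  have hcont : ContinuousOn (totalPhase cm cp) (Set.Ioi 0) := fun s hs =>
    ((continuousAt_id.add (hm.differentiableAt_phase hs).continuousAt).add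
      (continuousAt_id.add (hp.differentiableAt_phase hs).continuousAt)).continuousWithinAt
  have hlim : Filter.Tendsto (totalPhase cm cp) (nhdsWithin 0 (Set.Ioi 0))
      (nhds (cm.phaseZero + cp.phaseZero)) := by
    have hid : Filter.Tendsto (fun s : ℝ => s) (nhdsWithin 0 (Set.Ioi 0)) (nhds 0) :=
      nhdsWithin_le_nhds
    have h := (hid.add hm.tendsto_phase).add (hid.add hp.tendsto_phase)
    rwa [zero_add, zero_add] at h
  have hlo : ∃ s₁, 0 < s₁ ∧ totalPhase cm cp s₁ < y :=
    ((eventually_mem_nhdsWithin (a := (0 : ℝ)) (s := Set.Ioi 0)).and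
      (hlim.eventually_lt_const hy)).exists
  obtain ⟨s₁, hs₁, h1⟩ := hlo
  -- Each phase exceeds `-π/2`, so here the total phase exceeds `2 * |y| + π`.
  have hs₂ : 0 < |y| + Real.pi := by positivity
  have h2 : y ≤ totalPhase cm cp (|y| + Real.pi) := by
    have e1 := hm.neg_pi_div_two_lt_phase hs₂
    have e2 := hp.neg_pi_div_two_lt_phase hs₂
    rw [totalPhase]
    linarith [le_abs_self y, abs_nonneg y, Real.pi_pos]
  obtain ⟨s, hs, hsy⟩ := isPreconnected_Ioi.intermediate_value (Set.mem_Ioi.2 hs₁)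
    (Set.mem_Ioi.2 hs₂) hcont ⟨h1.le, h2⟩
  exact ⟨s, hs, hsy⟩

/-- Seen from the right end, the same sine has amplitude `-A` and phase `-2 * s - φ`. -/
theorem holds_iff (hm : cm.Small (-1) a b) (hp : cp.Small 1 a' b') (hs : 0 < s) {A φ : ℝ}
    {u : ℝ → ℝ} (hA : A ≠ 0) (hu : ∀ x ∈ I, u x = A * Real.sin (s * (x + 1) + φ) ∧
      D u x = A * s * Real.cos (s * (x + 1) + φ)) :
    MultiPointBC cm cp u ↔ (∃ n : ℤ, n * Real.pi = φ - cm.phase (-1) s) ∧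
      ∃ n : ℤ, n * Real.pi = -2 * s - φ - cp.phase 1 s := by
  refine and_congr ?_ ?_
  · rw [← hm.defect_eq_zero_iff hs]
    refine holds_iff_defect hm.end_eq hm.η_mem hA fun x hx => ?_
    rw [(hu x hx).1, (hu x hx).2, show s * (1 - -1 * x) + φ = s * (x + 1) + φ by ring]
    exact ⟨rfl, by ring⟩
  · rw [← hp.defect_eq_zero_iff hs]
    refine holds_iff_defect hp.end_eq hp.η_mem (neg_ne_zero.2 hA) fun x hx => ?_
    rw [(hu x hx).1, (hu x hx).2,
      show s * (1 - 1 * x) + (-2 * s - φ) = -(s * (x + 1) + φ) by ring, Real.sin_neg, Real.cos_neg]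
    exact ⟨by ring, by ring⟩

/-- The form of the eigenfunctions of positive eigenvalues. -/
theorem IsEigenfunction.eq_sin (hm : cm.Small (-1) a b) (hp : cp.Small 1 a' b') (hs : 0 < s)
    {u : ℝ → ℝ} (h : IsEigenfunction (MultiPointBC cm cp) (s ^ 2) u) :
    (∃ n : ℤ, totalPhase cm cp s = n * Real.pi) ∧
    ∃ A : ℝ, A ≠ 0 ∧ ∀ x ∈ I, u x = A * Real.sin (s * (x + 1) + cm.phase (-1) s) ∧
      D u x = A * s * Real.cos (s * (x + 1) + cm.phase (-1) s) := by
  obtain ⟨A, φ, hA, hu⟩ := h.exists_sin hs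
  obtain ⟨⟨n, hn⟩, k, hk⟩ := (holds_iff hm hp hs hA hu).1 h.2.2.1
  refine ⟨⟨-(n + k), ?_⟩, A * (-1) ^ n, mul_ne_zero hA (zpow_ne_zero _ (by norm_num)), ?_⟩
  · push_cast
    rw [totalPhase]
    linear_combination hn + hk
  · intro x hx
    rw [(hu x hx).1, (hu x hx).2, show s * (x + 1) + φ =
      s * (x + 1) + cm.phase (-1) s + n * Real.pi by rw [hn]; ring,
      Real.sin_add_int_mul_pi, Real.cos_add_int_mul_pi]
    exact ⟨by ring, by ring⟩

theorem sq_mem_eigenvalues (hm : cm.Small (-1) a b) (hp : cp.Small 1 a' b') (hs : 0 < s) {n : ℤ}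
    (hn : totalPhase cm cp s = n * Real.pi) : s ^ 2 ∈ eigenvalues (MultiPointBC cm cp) := by
  refine ⟨_, isEigenfunction_sin (φ := cm.phase (-1) s) hs
    ((holds_iff hm hp hs one_ne_zero fun x hx => ⟨rfl, D_sin hx⟩).2
      ⟨⟨0, by simp⟩, -n, ?_⟩)⟩
  rw [totalPhase] at hn
  push_cast
  linear_combination hn

/-! ### Nonpositive eigenvalues -/

/-- By `hsign` the two end-point terms do not have opposite signs, so their absolute values add; by
`hmax` the interior sums are at most `a` and `b` times those values, and `a + b < 1`. -/
theorem EndCondition.Small.eq_zero_of_endpoint_max {c : EndCondition} {e : ℝ}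
    (h : c.Small e a b) {u : ℝ → ℝ} (hu : c.Holds e u) (hsign : 0 ≤ e * (u e * D u e))
    (hmax : ∀ x ∈ I, |u x| ≤ |u e| ∧ |D u x| ≤ |D u e|) :
    c.α₀ * |u e| = 0 ∧ e * c.β₀ * |D u e| = 0 := by
  have h1 : |∑ i, c.α i * u (c.η i)| ≤ a * c.α₀ * |u e| := by
    refine (Finset.abs_sum_le_sum_abs _ _).trans (le_trans ?_
      (mul_le_mul_of_nonneg_right h.α_le (abs_nonneg _)))
    rw [Finset.sum_mul]
    refine Finset.sum_le_sum fun i _ => ?_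
    rw [abs_mul]
    exact mul_le_mul_of_nonneg_left (hmax _ (h.η_mem i)).1 (abs_nonneg _)
  have h2 : |∑ i, c.β i * D u (c.η i)| ≤ b * (e * c.β₀) * |D u e| := by
    refine (Finset.abs_sum_le_sum_abs _ _).trans (le_trans ?_
      (mul_le_mul_of_nonneg_right h.β_le (abs_nonneg _)))
    rw [Finset.sum_mul]
    refine Finset.sum_le_sum fun i _ => ?_
    rw [abs_mul]
    exact mul_le_mul_of_nonneg_left (hmax _ (h.η_mem i)).2 (abs_nonneg _)
  have h3 : |c.α₀ * u e + c.β₀ * D u e| = c.α₀ * |u e| + e * c.β₀ * |D u e| := by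
    have e1 : c.β₀ * D u e = e * c.β₀ * (e * D u e) := by
      linear_combination -(c.β₀ * D u e) * h.sq_eq_one
    have e2 : 0 ≤ c.α₀ * u e * (e * c.β₀ * (e * D u e)) := by
      have := mul_nonneg (mul_nonneg h.α₀_nonneg h.β₀_nonneg) hsign
      linarith
    rw [e1, abs_add_eq_add_abs_iff _ _ |>.2 (mul_nonneg_iff.1 e2), abs_mul c.α₀,
      abs_mul (e * c.β₀), abs_mul e (D u e),
      h.abs_e, one_mul, abs_of_nonneg h.α₀_nonneg, abs_of_nonneg h.β₀_nonneg]
  have h4 := abs_add_le (∑ i, c.α i * u (c.η i)) (∑ i, c.β i * D u (c.η i))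
  rw [Holds] at hu
  rw [← hu, h3] at h4
  have h5 := mul_nonneg h.α₀_nonneg (abs_nonneg (u e))
  have h6 := mul_nonneg h.β₀_nonneg (abs_nonneg (D u e))
  have h7 := h.add_lt_one
  have h8 := h.a_nonneg
  have h9 := h.b_nonneg
  constructor <;> nlinarith

theorem EndCondition.Small.α₀_eq_zero_of_const {c : EndCondition} {e : ℝ}
    (h : c.Small e a b) {u : ℝ → ℝ} (hu : c.Holds e u) (hD : ∀ x ∈ I, D u x = 0) {v : ℝ}
    (hv : v ≠ 0) (hconst : ∀ x ∈ I, u x = v) : c.α₀ = 0 := by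
  have heI : e ∈ I := by rcases h.end_eq with rfl | rfl <;> norm_num [I]
  have h1 : ∑ i, c.α i * u (c.η i) = (∑ i, c.α i) * v := by
    rw [Finset.sum_mul]
    exact Finset.sum_congr rfl fun i _ => by rw [hconst _ (h.η_mem i)]
  have h2 : ∑ i, c.β i * D u (c.η i) = 0 :=
    Finset.sum_eq_zero fun i _ => by rw [hD _ (h.η_mem i), mul_zero]
  rw [Holds, h1, h2, hconst e heI, hD e heI, mul_zero, add_zero, add_zero] at hu
  have h3 := mul_right_cancel₀ hv hu
  have h4 := (le_abs_self _).trans ((Finset.abs_sum_le_sum_abs c.α Finset.univ).trans h.α_le)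
  have h5 := h.α₀_nonneg
  have h6 := h.add_lt_one
  have h7 := h.b_nonneg
  nlinarith

/-- There are no negative eigenvalues, and `0` is an eigenvalue only in the case `α₀⁻ = α₀⁺ = 0`. -/
theorem IsEigenfunction.eq_zero_of_nonpos (hm : cm.Small (-1) a b) (hp : cp.Small 1 a' b')
    {lam : ℝ} (hlam : lam ≤ 0) {u : ℝ → ℝ} (h : IsEigenfunction (MultiPointBC cm cp) lam u) :
    lam = 0 ∧ cm.α₀ = 0 ∧ cp.α₀ = 0 := by
  obtain ⟨e, he, hsign, hmax⟩ := h.exists_endpoint_max hlam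
  obtain ⟨x, hx, hux⟩ := h.2.2.2
  have hue : 0 < |u e| := (abs_pos.2 hux).trans_le (hmax x hx).1
  have hDe : D u e = 0 := by
    have key : ∀ {c : EndCondition} {a b : ℝ}, c.Small e a b → c.Holds e u → D u e = 0 := by
      intro c a b hc hB
      obtain ⟨h1, h2⟩ := hc.eq_zero_of_endpoint_max hB hsign hmax
      have h0 := (mul_eq_zero.1 h1).resolve_right hue.ne'
      have h3 := hc.nontrivial
      rw [h0, zero_add] at h3
      exact abs_eq_zero.1 ((mul_eq_zero.1 h2).resolve_left h3.ne')
    rcases he with rfl | rfl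
    · exact key hm h.2.2.1.1
    · exact key hp h.2.2.1.2
  have hD : ∀ y ∈ I, D u y = 0 := fun y hy => by
    have := (hmax y hy).2
    rw [hDe, abs_zero] at this
    exact abs_eq_zero.1 (le_antisymm this (abs_nonneg _))
  have hconst := eq_left_of_hasDerivAt_zero h.1.continuousOn fun y hy => by
    simpa [hD y (Ioo_subset_I hy)] using h.1.hasDerivAt hy
  have hv : u (-1) ≠ 0 := by rwa [← hconst x hx]
  refine ⟨?_, hm.α₀_eq_zero_of_const h.2.2.1.1 hD hv hconst,
    hp.α₀_eq_zero_of_const h.2.2.1.2 hD hv hconst⟩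
  have h0 : (0 : ℝ) ∈ Set.Ioo (-1 : ℝ) 1 := by norm_num
  have h1 := h.2.1 0 h0
  rw [show D (D u) 0 = D (fun _ => (0 : ℝ)) 0 from D_congr hD (Ioo_subset_I h0),
    D_eq_of_hasDerivAt (Ioo_subset_I h0) (hasDerivAt_const _ _), neg_zero,
    hconst 0 (Ioo_subset_I h0)] at h1
  exact (mul_eq_zero.1 h1.symm).resolve_right hv

theorem EndCondition.Small.holds_one {c : EndCondition} {e : ℝ} (h : c.Small e a b)
    (h0 : c.α₀ = 0) : c.Holds e (fun _ => 1) := by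
  have heI : e ∈ I := by rcases h.end_eq with rfl | rfl <;> norm_num [I]
  have hD : ∀ x ∈ I, D (fun _ => (1 : ℝ)) x = 0 := fun x hx =>
    D_eq_of_hasDerivAt hx (hasDerivAt_const _ _)
  have hα : ∀ i, c.α i = 0 := fun i => by
    have h1 := h.α_le
    rw [h0, mul_zero] at h1
    exact abs_eq_zero.1 (le_antisymm ((Finset.single_le_sum (f := fun i => |c.α i|)
      (fun _ _ => abs_nonneg _) (Finset.mem_univ i)).trans h1) (abs_nonneg _))
  rw [Holds, hD e heI, h0]
  simp [hα, fun i => hD _ (h.η_mem i)]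

theorem zero_mem_eigenvalues (hm : cm.Small (-1) a b) (hp : cp.Small 1 a' b')
    (hm0 : cm.α₀ = 0) (hp0 : cp.α₀ = 0) : 0 ∈ eigenvalues (MultiPointBC cm cp) := by
  refine ⟨fun _ => 1, contDiffOn_const, fun x hx => ?_, ⟨hm.holds_one hm0, hp.holds_one hp0⟩,
    0, by norm_num [I], one_ne_zero⟩
  have hD : ∀ x ∈ I, D (fun _ => (1 : ℝ)) x = 0 := fun x hx =>
    D_eq_of_hasDerivAt hx (hasDerivAt_const _ _)
  rw [D_congr (v := fun _ => 0) hD (Ioo_subset_I hx),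
    D_eq_of_hasDerivAt (Ioo_subset_I hx) (hasDerivAt_const _ _)]
  simp

/-! ### Enumeration of the spectrum -/

/-- `r k` is the square root of the `k`-th eigenvalue. -/
structure IsRootSequence (cm cp : EndCondition) (r : ℕ → ℝ) : Prop where
  strictMono : StrictMono r
  nonneg : ∀ k, 0 ≤ r k
  spec : ∀ k, (0 < r k ∧ totalPhase cm cp (r k) = (k + 1) * Real.pi) ∨
    (k = 0 ∧ r k = 0 ∧ cm.α₀ = 0 ∧ cp.α₀ = 0)
  enumerates : Enumerates (fun k => r k ^ 2) (eigenvalues (MultiPointBC cm cp))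

theorem phaseZero_nonneg (c : EndCondition) : 0 ≤ c.phaseZero := by
  unfold phaseZero
  split_ifs
  · positivity
  · exact le_rfl

theorem phaseZero_le (c : EndCondition) : c.phaseZero ≤ Real.pi / 2 := by
  unfold phaseZero
  split_ifs
  · exact le_rfl
  · positivity

theorem phaseZero_lt_of_ne {c : EndCondition} (h : c.α₀ ≠ 0) : c.phaseZero < Real.pi / 2 := by
  rw [phaseZero, if_neg h]
  positivity

theorem phaseZero_of_eq {c : EndCondition} (h : c.α₀ = 0) : c.phaseZero = Real.pi / 2 := by
  rw [phaseZero, if_pos h]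

theorem exists_isRootSequence (hm : cm.Small (-1) a b) (hp : cp.Small 1 a' b') :
    ∃ r, IsRootSequence cm cp r := by
  have hpi := Real.pi_pos
  have hex : ∀ k : ℕ, ∃ r : ℝ, 0 ≤ r ∧
      ((0 < r ∧ totalPhase cm cp r = (k + 1) * Real.pi) ∨
        (k = 0 ∧ r = 0 ∧ cm.α₀ = 0 ∧ cp.α₀ = 0)) := by
    intro k
    by_cases h0 : k = 0 ∧ cm.α₀ = 0 ∧ cp.α₀ = 0
    · exact ⟨0, le_rfl, Or.inr ⟨h0.1, rfl, h0.2⟩⟩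
    -- The limits at `0+` sum to at most `π`, with equality only if both `α₀` vanish. In that case
    -- the level `π` is not attained at any `s > 0`, and the eigenvalue `0` takes the index `k = 0`.
    have hlt : cm.phaseZero + cp.phaseZero < (k + 1) * Real.pi := by
      have h1 := phaseZero_le cm
      have h2 := phaseZero_le cp
      rcases Nat.eq_zero_or_pos k with hk | hk
      · subst hk
        rw [Nat.cast_zero, zero_add, one_mul]
        by_cases h3 : cm.α₀ = 0
        · have := phaseZero_lt_of_ne (c := cp) fun h4 => h0 ⟨rfl, h3, h4⟩
          linarith
        · have := phaseZero_lt_of_ne h3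
          linarith
      · have hk' : (1 : ℝ) ≤ k := by exact_mod_cast hk
        nlinarith
    obtain ⟨s, hs, hsy⟩ := exists_totalPhase_eq hm hp hlt
    exact ⟨s, hs.le, Or.inl ⟨hs, hsy⟩⟩
  choose r hr0 hr using hex
  have hmono : StrictMono r := by
    refine strictMono_nat_of_lt_succ fun k => ?_
    obtain ⟨h1, h2⟩ := (hr (k + 1)).resolve_right fun h => Nat.succ_ne_zero k h.1
    rcases hr k with ⟨h3, h4⟩ | ⟨-, h3, -⟩
    · rw [← (strictMonoOn_totalPhase hm hp).lt_iff_lt h3 h1, h2, h4]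
      push_cast
      linarith
    · rwa [h3]
  refine ⟨r, hmono, hr0, hr, fun i j hij => ?_, Set.Subset.antisymm ?_ ?_⟩
  · exact pow_lt_pow_left₀ (hmono hij) (hr0 i) two_ne_zero
  · rintro _ ⟨k, rfl⟩
    rcases hr k with ⟨h1, h2⟩ | ⟨-, h1, h2, h3⟩
    · exact sq_mem_eigenvalues hm hp h1 (n := k + 1) (by rw [h2]; push_cast; ring)
    · simp only [h1, ne_eq, OfNat.ofNat_ne_zero, not_false_eq_true, zero_pow]
      exact zero_mem_eigenvalues hm hp h2 h3
  · rintro lam ⟨u, hu⟩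
    rcases le_or_gt lam 0 with hle | hlt
    · obtain ⟨rfl, h1, h2⟩ := hu.eq_zero_of_nonpos hm hp hle
      refine ⟨0, ?_⟩
      rcases hr 0 with ⟨h3, h4⟩ | ⟨-, h3, -⟩
      · have := phaseZero_add_lt_totalPhase hm hp h3
        rw [h4, phaseZero_of_eq h1, phaseZero_of_eq h2, Nat.cast_zero] at this
        linarith
      · simp [h3]
    · have hs : 0 < √lam := Real.sqrt_pos.2 hlt
      have hsq : √lam ^ 2 = lam := Real.sq_sqrt hlt.le
      rw [← hsq] at hu
      obtain ⟨⟨n, hn⟩, -⟩ := hu.eq_sin hm hp hs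
      have hpos := phaseZero_add_lt_totalPhase hm hp hs
      have hn0 : (0 : ℝ) < n := by
        have h1 := phaseZero_nonneg cm
        have h2 := phaseZero_nonneg cp
        rw [hn] at hpos
        exact pos_of_mul_pos_left (by linarith) hpi.le
      have hn1 : 0 < n := by exact_mod_cast hn0
      obtain ⟨k, rfl⟩ : ∃ k : ℕ, n = k + 1 := ⟨(n - 1).toNat, by omega⟩
      refine ⟨k, ?_⟩
      push_cast at hn
      rcases hr k with ⟨h3, h4⟩ | ⟨h3, -, h4, h5⟩
      · have : r k = √lam :=
          (strictMonoOn_totalPhase hm hp).injOn h3 hs (h4.trans hn.symm)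
        rw [← hsq, ← this]
      · rw [hn, phaseZero_of_eq h4, phaseZero_of_eq h5, h3, Nat.cast_zero] at hpos
        linarith

/-! ### Zero counts and nodal sets -/

theorem encard_sin_zeros {s φ : ℝ} {m : ℕ} (hs : 0 < s) (hφ : φ ∈ Set.Ioo 0 Real.pi)
    (hend : s * 2 + φ ∈ Set.Ioo (m * Real.pi) ((m + 1) * Real.pi)) :
    {x ∈ Set.Ioo (-1 : ℝ) 1 | Real.sin (s * (x + 1) + φ) = 0}.encard = m := by
  have hpi := Real.pi_pos
  set f : ℕ → ℝ := fun n => ((n + 1) * Real.pi - φ) / s - 1 with hf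
  have hfs : ∀ n, s * (f n + 1) + φ = (n + 1) * Real.pi := fun n => by
    rw [hf]
    field_simp
    ring
  have hinj : Function.Injective f := fun i j hij => by
    have h1 := hfs i
    rw [hij, hfs j] at h1
    have h2 := mul_right_cancel₀ hpi.ne' h1
    exact_mod_cast (add_right_cancel h2).symm
  have heq : {x ∈ Set.Ioo (-1 : ℝ) 1 | Real.sin (s * (x + 1) + φ) = 0} =
      f '' (Finset.range m : Set ℕ) := by
    ext x
    simp only [Set.mem_ofPred_eq, Set.mem_image, Finset.coe_range, Set.mem_Iio, Set.mem_Ioo]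
    constructor
    · rintro ⟨⟨h1, h2⟩, h3⟩
      obtain ⟨n, hn⟩ := Real.sin_eq_zero_iff.1 h3
      have h4 : s * (x + 1) < s * 2 := mul_lt_mul_of_pos_left (by linarith) hs
      have h5 : 0 < s * (x + 1) := mul_pos hs (by linarith)
      have hn0 : (0 : ℝ) < n := pos_of_mul_pos_left (b := Real.pi) (by linarith [hφ.1]) hpi.le
      have hnm : (n : ℝ) < m + 1 := lt_of_mul_lt_mul_right (by linarith [hend.2]) hpi.le
      have hn0' : 0 < n := by exact_mod_cast hn0
      have hnm' : n < m + 1 := by exact_mod_cast hnm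
      obtain ⟨k, rfl⟩ : ∃ k : ℕ, n = k + 1 := ⟨(n - 1).toNat, by omega⟩
      refine ⟨k, by omega, ?_⟩
      have h6 := hfs k
      push_cast at hn
      have h7 : s * (f k + 1) = s * (x + 1) := by linarith
      linarith [mul_left_cancel₀ hs.ne' h7]
    · rintro ⟨n, hn, rfl⟩
      have h1 := hfs n
      have hn' : (n : ℝ) + 1 ≤ m := by exact_mod_cast hn
      have h2 : ((n : ℝ) + 1) * Real.pi ≤ m * Real.pi := mul_le_mul_of_nonneg_right hn' hpi.le
      have h3 : 0 ≤ (n : ℝ) * Real.pi := by positivity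
      have h4 : 0 < f n + 1 := pos_of_mul_pos_right (a := s) (by linarith [hφ.2]) hs.le
      have h5 : f n + 1 < 2 := lt_of_mul_lt_mul_left (a := s) (by linarith [hend.1]) hs.le
      refine ⟨⟨by linarith, by linarith⟩, ?_⟩
      rw [h1]
      exact_mod_cast Real.sin_nat_mul_pi (n + 1)
  rw [heq, hinj.injOn.encard_image, Set.encard_coe_eq_coe_finsetCard, Finset.card_range]

section Nodal

variable {u : ℝ → ℝ} {A s φ : ℝ} {k : ℕ}

theorem mem_SPlus (hC : IsC2 u) (hs : 0 < s) (hA : 0 < A)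
    (hu : ∀ x ∈ I, u x = A * Real.sin (s * (x + 1) + φ) ∧
      D u x = A * s * Real.cos (s * (x + 1) + φ))
    (hφ : φ ∈ Set.Ioo 0 Real.pi)
    (hend : s * 2 + φ ∈ Set.Ioo (k * Real.pi) ((k + 1) * Real.pi)) : u ∈ SPlus k := by
  have hl : u (-1) = A * Real.sin φ := by simpa using (hu (-1) (by norm_num [I])).1
  have hlpos : 0 < u (-1) := by
    rw [hl]
    exact mul_pos hA (Real.sin_pos_of_pos_of_lt_pi hφ.1 hφ.2)
  have hzero : ∀ x ∈ I, u x = 0 ↔ Real.sin (s * (x + 1) + φ) = 0 := fun x hx => by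
    rw [(hu x hx).1, mul_eq_zero_iff_left hA.ne']
  refine ⟨hC, hlpos.ne', fun h1 => ?_, hlpos, fun x hx h0 h1 => ?_, ?_⟩
  · obtain ⟨n, hn⟩ := Real.sin_eq_zero_iff.1 ((hzero 1 (by norm_num [I])).1 h1)
    rw [one_add_one_eq_two] at hn
    rw [← hn] at hend
    have h2 : (k : ℝ) < n := lt_of_mul_lt_mul_right hend.1 Real.pi_pos.le
    have h3 : (n : ℝ) < k + 1 := lt_of_mul_lt_mul_right hend.2 Real.pi_pos.le
    have h2' : (k : ℤ) < n := by exact_mod_cast h2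
    have h3' : n < (k : ℤ) + 1 := by exact_mod_cast h3
    omega
  · have e1 := (hzero x (Ioo_subset_I hx)).1 h0
    rw [(hu x (Ioo_subset_I hx)).2, mul_eq_zero_iff_left (mul_pos hA hs).ne'] at h1
    have := Real.sin_sq_add_cos_sq (s * (x + 1) + φ)
    rw [e1, h1] at this
    norm_num at this
  · rw [← encard_sin_zeros hs hφ hend]
    congr 1
    ext x
    exact and_congr_right fun hx => hzero x (Ioo_subset_I hx)

theorem mem_TPlus (hC : IsC2 u) (hs : 0 < s) (hA : 0 < A)
    (hu : ∀ x ∈ I, u x = A * Real.sin (s * (x + 1) + φ) ∧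
      D u x = A * s * Real.cos (s * (x + 1) + φ))
    (hφ : φ + Real.pi / 2 ∈ Set.Ioo 0 Real.pi)
    (hend : s * 2 + (φ + Real.pi / 2) ∈ Set.Ioo (k * Real.pi) ((k + 1) * Real.pi)) :
    u ∈ TPlus k := by
  have hpi := Real.pi_pos
  have hAs := mul_pos hA hs
  have hl : D u (-1) = A * s * Real.cos φ := by simpa using (hu (-1) (by norm_num [I])).2
  have hlpos : 0 < D u (-1) := by
    rw [hl]
    exact mul_pos hAs (Real.cos_pos_of_mem_Ioo ⟨by linarith [hφ.1], by linarith [hφ.2]⟩)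
  have hzero : ∀ x ∈ I, D u x = 0 ↔ Real.sin (s * (x + 1) + (φ + Real.pi / 2)) = 0 :=
    fun x hx => by
      rw [(hu x hx).2, mul_eq_zero_iff_left hAs.ne', ← add_assoc, Real.sin_add_pi_div_two]
  refine ⟨hC, hlpos.ne', fun h1 => ?_, hlpos, fun x hx h0 h1 => ?_, ?_, ?_⟩
  · obtain ⟨n, hn⟩ := Real.sin_eq_zero_iff.1 ((hzero 1 (by norm_num [I])).1 h1)
    rw [one_add_one_eq_two] at hn
    rw [← hn] at hend
    have h2 : (k : ℝ) < n := lt_of_mul_lt_mul_right hend.1 hpi.le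
    have h3 : (n : ℝ) < k + 1 := lt_of_mul_lt_mul_right hend.2 hpi.le
    have h2' : (k : ℤ) < n := by exact_mod_cast h2
    have h3' : n < (k : ℤ) + 1 := by exact_mod_cast h3
    omega
  · rw [(hu x (Ioo_subset_I hx)).2, mul_eq_zero_iff_left hAs.ne'] at h0
    rw [D_congr (fun y hy => (hu y hy).2) (Ioo_subset_I hx), D_cos (Ioo_subset_I hx),
      neg_eq_zero, mul_eq_zero_iff_left (mul_pos hAs hs).ne'] at h1
    have := Real.sin_sq_add_cos_sq (s * (x + 1) + φ)
    rw [h0, h1] at this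
    norm_num at this
  · rw [← encard_sin_zeros hs hφ hend]
    congr 1
    ext x
    exact and_congr_right fun hx => hzero x (Ioo_subset_I hx)
  · intro x hx y hy hxy hx0 hy0 _
    obtain ⟨n, hn⟩ := Real.sin_eq_zero_iff.1 ((hzero x (Ioo_subset_I hx)).1 hx0)
    obtain ⟨m, hm⟩ := Real.sin_eq_zero_iff.1 ((hzero y (Ioo_subset_I hy)).1 hy0)
    have hsxy := mul_lt_mul_of_pos_left hxy hs
    have hnm : (n : ℝ) < m := lt_of_mul_lt_mul_right (a := Real.pi) (by linarith) hpi.le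
    have hnm' : (n : ℝ) + 1 ≤ m := by exact_mod_cast hnm
    have hnmpi := mul_le_mul_of_nonneg_right hnm' hpi.le
    -- The zeros `x`, `y` of `u'` have angles `n * π - π/2` and at least `n * π + π/2`; at `z` the
    -- angle is `n * π`.
    set z : ℝ := (n * Real.pi - φ) / s - 1 with hz
    have hzs : s * (z + 1) + φ = n * Real.pi := by
      rw [hz]
      field_simp
      ring
    have hxz : x < z := lt_of_mul_lt_mul_left (a := s) (by linarith) hs.le
    have hzy : z < y := lt_of_mul_lt_mul_left (a := s) (by linarith) hs.le
    refine ⟨z, ⟨hxz, hzy⟩, ?_⟩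
    rw [(hu z ⟨(hx.1.trans hxz).le, (hzy.trans hy.2).le⟩).1, hzs, Real.sin_int_mul_pi, mul_zero]

theorem mem_S (hC : IsC2 u) (hs : 0 < s) (hA : A ≠ 0)
    (hu : ∀ x ∈ I, u x = A * Real.sin (s * (x + 1) + φ) ∧
      D u x = A * s * Real.cos (s * (x + 1) + φ))
    (hφ : φ ∈ Set.Ioo 0 Real.pi)
    (hend : s * 2 + φ ∈ Set.Ioo (k * Real.pi) ((k + 1) * Real.pi)) : u ∈ S k := by
  rcases hA.lt_or_gt with h | h
  · refine Or.inr (mem_SPlus hC.neg hs (neg_pos.2 h) (fun x hx => ?_) hφ hend)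
    rw [D_neg, Pi.neg_apply, Pi.neg_apply, (hu x hx).1, (hu x hx).2]
    exact ⟨by ring, by ring⟩
  · exact Or.inl (mem_SPlus hC hs h hu hφ hend)

theorem mem_T (hC : IsC2 u) (hs : 0 < s) (hA : A ≠ 0)
    (hu : ∀ x ∈ I, u x = A * Real.sin (s * (x + 1) + φ) ∧
      D u x = A * s * Real.cos (s * (x + 1) + φ))
    (hφ : φ + Real.pi / 2 ∈ Set.Ioo 0 Real.pi)
    (hend : s * 2 + (φ + Real.pi / 2) ∈ Set.Ioo (k * Real.pi) ((k + 1) * Real.pi)) :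
    u ∈ T k := by
  rcases hA.lt_or_gt with h | h
  · refine Or.inr (mem_TPlus hC.neg hs (neg_pos.2 h) (fun x hx => ?_) hφ hend)
    rw [D_neg, Pi.neg_apply, Pi.neg_apply, (hu x hx).1, (hu x hx).2]
    exact ⟨by ring, by ring⟩
  · exact Or.inl (mem_TPlus hC hs h hu hφ hend)

end Nodal

/-! ### Neumann and Dirichlet spectra from the same enumeration -/

/-- The Neumann condition as a degenerate multi-point condition. -/
def neumannEnd (e : ℝ) : EndCondition := ⟨1, 0, e, fun _ => 0, fun _ => 0, fun _ => 0⟩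

/-- The Dirichlet condition as a degenerate multi-point condition. -/
def dirichletEnd : EndCondition := ⟨1, 1, 0, fun _ => 0, fun _ => 0, fun _ => 0⟩

theorem small_neumannEnd {e : ℝ} (he : e = -1 ∨ e = 1) : (neumannEnd e).Small e 0 0 := by
  have h1 : e * e = 1 := by rcases he with rfl | rfl <;> norm_num
  constructor <;> simp [neumannEnd, I, h1, he]

theorem small_dirichletEnd {e : ℝ} (he : e = -1 ∨ e = 1) : dirichletEnd.Small e 0 0 := by
  constructor <;> simp [dirichletEnd, I, he]

theorem phase_neumannEnd {e s : ℝ} (he : e = -1 ∨ e = 1) (hs : 0 < s) :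
    (neumannEnd e).phase e s = Real.pi / 2 := by
  have h1 : e * e = 1 := by rcases he with rfl | rfl <;> norm_num
  have h2 : (neumannEnd e).phaseVec e s = (s : ℂ) * Complex.I := by
    apply Complex.ext <;> simp [phaseVec, defect_zero, defect_pi_div_two, neumannEnd, h1]
  rw [phase, h2, Complex.arg_real_mul _ hs, Complex.arg_I]

theorem phase_dirichletEnd (e s : ℝ) : dirichletEnd.phase e s = 0 := by
  have h2 : dirichletEnd.phaseVec e s = 1 := by
    apply Complex.ext <;> simp [phaseVec, defect_zero, defect_pi_div_two, dirichletEnd]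
  rw [phase, h2, Complex.arg_one]

theorem multiPointBC_neumannEnd :
    MultiPointBC (neumannEnd (-1)) (neumannEnd 1) = Neumann := by
  funext u
  simp [MultiPointBC, Neumann, Holds, neumannEnd]

theorem multiPointBC_dirichletEnd : MultiPointBC dirichletEnd dirichletEnd = Dirichlet := by
  funext u
  simp [MultiPointBC, Dirichlet, Holds, dirichletEnd]

theorem enumerates_neumann :
    Enumerates (fun k : ℕ => (k * (Real.pi / 2)) ^ 2) (eigenvalues Neumann) := by
  obtain ⟨r, hr⟩ := exists_isRootSequence (small_neumannEnd (Or.inl rfl))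
    (small_neumannEnd (Or.inr rfl))
  have h : ∀ k, r k = k * (Real.pi / 2) := by
    intro k
    rcases hr.spec k with ⟨h1, h2⟩ | ⟨rfl, h1, -⟩
    · rw [totalPhase, phase_neumannEnd (Or.inl rfl) h1, phase_neumannEnd (Or.inr rfl) h1] at h2
      linarith
    · rw [h1, Nat.cast_zero, zero_mul]
  simpa only [h, multiPointBC_neumannEnd] using hr.enumerates

theorem enumerates_dirichlet :
    Enumerates (fun k : ℕ => ((k + 1) * (Real.pi / 2)) ^ 2) (eigenvalues Dirichlet) := by
  obtain ⟨r, hr⟩ := exists_isRootSequence (small_dirichletEnd (Or.inl rfl))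
    (small_dirichletEnd (Or.inr rfl))
  have h : ∀ k, r k = (k + 1) * (Real.pi / 2) := by
    intro k
    rcases hr.spec k with ⟨h1, h2⟩ | ⟨-, -, h1, -⟩
    · rw [totalPhase, phase_dirichletEnd, phase_dirichletEnd] at h2
      linarith
    · norm_num [dirichletEnd] at h1
  simpa only [h, multiPointBC_dirichletEnd] using hr.enumerates

/-! ### The thresholds `J`, `kT` and `kS` -/

namespace EndCondition.Small

variable {c : EndCondition} {e a b s : ℝ}

theorem abs_β₀ (h : c.Small e a b) : |c.β₀| = e * c.β₀ := by
  rw [← abs_of_nonneg h.β₀_nonneg, abs_mul, h.abs_e, one_mul]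

theorem abs_phase_lt_of_le_J (h : c.Small e a b) (hs : 0 < s) (hJ : ((s ^ 2 : ℝ) : EReal) ≤ c.J) :
    |c.phase e s| < Real.pi / 2 := by
  have hle : s * (e * c.β₀) ≤ c.α₀ := by
    rw [← h.abs_β₀]
    by_cases h0 : c.β₀ = 0
    · rw [h0, abs_zero, mul_zero]
      exact h.α₀_nonneg
    · rw [J, if_neg h0, EReal.coe_le_coe_iff, sq_le_sq, abs_div, le_div_iff₀ (abs_pos.2 h0),
        abs_of_pos hs, abs_of_nonneg h.α₀_nonneg] at hJ
      exact hJ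
  refine h.abs_phase_lt hs.le (lt_of_le_of_ne h.α₀_nonneg fun h0 => ?_) hle
  have h1 := h.nontrivial
  rw [← h0, zero_add] at h1
  rw [← h0] at hle
  linarith [mul_pos hs h1]

theorem phase_mem_Ioo_of_J_le (h : c.Small e a b) (hs : 0 < s)
    (hJ : c.J ≤ ((s ^ 2 : ℝ) : EReal)) : c.phase e s ∈ Set.Ioo 0 Real.pi := by
  refine h.phase_mem_Ioo hs ?_
  rw [← h.abs_β₀]
  by_cases h0 : c.β₀ = 0
  · rw [J, if_pos h0, top_le_iff] at hJ
    exact absurd hJ (EReal.coe_ne_top _)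
  · rw [J, if_neg h0, EReal.coe_le_coe_iff, sq_le_sq, abs_div, div_le_iff₀ (abs_pos.2 h0),
      abs_of_pos hs, abs_of_nonneg h.α₀_nonneg] at hJ
    exact hJ

end EndCondition.Small

theorem le_min_J_of_le_kT {cm cp : EndCondition} {l : ℕ → ℝ} (hl : StrictMono l) {k : ℕ}
    (h : (k : ℕ∞) + 2 ≤ kT cm cp l) : ((l (k + 2) : ℝ) : EReal) ≤ min cm.J cp.J := by
  by_contra hcon
  have hle : kT cm cp l ≤ ((k + 1 : ℕ) : ℕ∞) := by
    refine sSup_le ?_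
    rintro _ ⟨j, rfl, hj⟩
    have : j ≤ k + 1 := by
      by_contra! hlt
      exact hcon ((EReal.coe_le_coe_iff.2 (hl.monotone (show k + 2 ≤ j from hlt))).trans hj)
    exact_mod_cast this
  have h1 : ((k + 2 : ℕ) : ℕ∞) ≤ ((k + 1 : ℕ) : ℕ∞) := le_trans (by exact_mod_cast h) hle
  have h2 : k + 2 ≤ k + 1 := by exact_mod_cast h1
  omega

/-- A finite `kS` is attained. The bound `2 ≤ k` ensures that the natural subtraction `k - 2` is not
truncated. -/
theorem max_J_le_of_kS_le {cm cp : EndCondition} {l : ℕ → ℝ} (hl : StrictMono l) {k : ℕ}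
    (h : kS cm cp l + 2 ≤ (k : ℕ∞)) :
    2 ≤ k ∧ max cm.J cp.J ≤ ((l (k - 2) : ℝ) : EReal) := by
  have hne : {n : ℕ∞ | ∃ j : ℕ, n = (j : ℕ∞) ∧
      max cm.J cp.J ≤ ((l j : ℝ) : EReal)}.Nonempty := by
    by_contra hemp
    rw [Set.not_nonempty_iff_eq_empty] at hemp
    rw [kS, hemp, sInf_empty, top_add, top_le_iff] at h
    exact ENat.natCast_ne_top k h
  obtain ⟨j, hj, hJ⟩ := csInf_mem hne
  rw [kS, hj] at h
  have h1 : j + 2 ≤ k := by exact_mod_cast h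
  exact ⟨by omega, hJ.trans (EReal.coe_le_coe_iff.2 (hl.monotone (by omega)))⟩

/-! ### Location of eigenvalues and eigenfunctions -/

section Main

variable {cm cp : EndCondition} {a b a' b' : ℝ} {r : ℕ → ℝ} {k : ℕ}

theorem IsRootSequence.low (hr : IsRootSequence cm cp r) (hm : cm.Small (-1) a b)
    (hp : cp.Small 1 a' b')
    (hJ : ((((k + 2 : ℕ) * (Real.pi / 2)) ^ 2 : ℝ) : EReal) ≤ min cm.J cp.J) :
    (∀ ψ, IsEigenfunction (MultiPointBC cm cp) (r k ^ 2) ψ → ψ ∈ T (k + 1)) ∧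
      k * (Real.pi / 2) < r k ∧ r k < (k + 2 : ℕ) * (Real.pi / 2) := by
  have hpi := Real.pi_pos
  have hphase : ∀ s, 0 < s → s ≤ (k + 2 : ℕ) * (Real.pi / 2) →
      |cm.phase (-1) s| < Real.pi / 2 ∧ |cp.phase 1 s| < Real.pi / 2 := by
    intro s hs hle
    have h1 := (EReal.coe_le_coe_iff.2 (pow_le_pow_left₀ hs.le hle 2)).trans hJ
    rw [le_min_iff] at h1
    exact ⟨hm.abs_phase_lt_of_le_J hs h1.1, hp.abs_phase_lt_of_le_J hs h1.2⟩
  have hmono := strictMonoOn_totalPhase hm hp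
  have hs2 : 0 < ((k + 2 : ℕ) : ℝ) * (Real.pi / 2) := by positivity
  obtain ⟨hm2, hp2⟩ := hphase _ hs2 le_rfl
  obtain ⟨hpos, htot⟩ : 0 < r k ∧ totalPhase cm cp (r k) = (k + 1) * Real.pi := by
    -- A zero root would force `α₀ = 0`, hence `J = 0`, below a positive Neumann eigenvalue.
    refine (hr.spec k).resolve_right fun h => ?_
    have hJm := (le_min_iff.1 hJ).1
    have hβ : cm.β₀ ≠ 0 := fun h0 => by
      have := hm.nontrivial
      rw [h.2.2.1, h0] at this
      norm_num at this
    rw [J, if_neg hβ, h.2.2.1, EReal.coe_le_coe_iff, zero_div] at hJm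
    nlinarith
  have hupper : r k < (k + 2 : ℕ) * (Real.pi / 2) := by
    -- Both phases exceed `-π/2`, so the total phase at `(k + 2) * π / 2` exceeds `(k + 1) * π`.
    rw [← hmono.lt_iff_lt hpos hs2, htot, totalPhase]
    push_cast at hm2 hp2 ⊢
    linarith [(abs_lt.1 hm2).1, (abs_lt.1 hp2).1]
  have hlower : k * (Real.pi / 2) < r k := by
    rcases Nat.eq_zero_or_pos k with rfl | hk
    · simpa using hpos
    have hs0 : 0 < (k : ℝ) * (Real.pi / 2) := by positivity
    obtain ⟨hm0, hp0⟩ := hphase _ hs0 (by push_cast; linarith)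
    rw [← hmono.lt_iff_lt hs0 hpos, htot, totalPhase]
    linarith [(abs_lt.1 hm0).2, (abs_lt.1 hp0).2]
  refine ⟨fun ψ hψ => ?_, hlower, hupper⟩
  obtain ⟨-, A, hA, hu⟩ := hψ.eq_sin hm hp hpos
  obtain ⟨hm1, hp1⟩ := hphase _ hpos hupper.le
  rw [abs_lt] at hm1 hp1
  rw [totalPhase] at htot
  -- The shifted angle at the right end is `(k + 1) * π + π/2 - phase⁺`, which lies between `(k + 1)
  -- * π` and `(k + 2) * π`.
  refine mem_T hψ.1 hpos hA hu ⟨by linarith, by linarith⟩ ⟨?_, ?_⟩ <;>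
  · push_cast
    linarith

theorem IsRootSequence.high (hr : IsRootSequence cm cp r) (hm : cm.Small (-1) a b)
    (hp : cp.Small 1 a' b') (hk : 2 ≤ k)
    (hJ : max cm.J cp.J ≤ (((((k - 2 : ℕ) + 1) * (Real.pi / 2)) ^ 2 : ℝ) : EReal)) :
    (∀ ψ, IsEigenfunction (MultiPointBC cm cp) (r k ^ 2) ψ → ψ ∈ S k) ∧
      ((k - 2 : ℕ) + 1) * (Real.pi / 2) < r k ∧ r k < (k + 1) * (Real.pi / 2) := by
  have hpi := Real.pi_pos
  have hs0 : 0 < (((k - 2 : ℕ) : ℝ) + 1) * (Real.pi / 2) := by positivity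
  have hphase : ∀ s, ((k - 2 : ℕ) + 1) * (Real.pi / 2) ≤ s →
      cm.phase (-1) s ∈ Set.Ioo 0 Real.pi ∧ cp.phase 1 s ∈ Set.Ioo 0 Real.pi := by
    intro s hle
    have h1 := hJ.trans (EReal.coe_le_coe_iff.2 (pow_le_pow_left₀ hs0.le hle 2))
    rw [max_le_iff] at h1
    exact ⟨hm.phase_mem_Ioo_of_J_le (hs0.trans_le hle) h1.1,
      hp.phase_mem_Ioo_of_J_le (hs0.trans_le hle) h1.2⟩
  have hcast : ((k - 2 : ℕ) : ℝ) = k - 2 := by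
    rw [Nat.cast_sub hk]
    norm_num
  have hmono := strictMonoOn_totalPhase hm hp
  obtain ⟨hpos, htot⟩ : 0 < r k ∧ totalPhase cm cp (r k) = (k + 1) * Real.pi :=
    (hr.spec k).resolve_right fun h => by omega
  have hlower : ((k - 2 : ℕ) + 1) * (Real.pi / 2) < r k := by
    obtain ⟨hm0, hp0⟩ := hphase _ le_rfl
    -- Phases below `π` keep the total phase at `(k - 1) * π / 2` below `(k + 1) * π`; for the upper
    -- bound below, positive phases suffice.
    rw [← hmono.lt_iff_lt hs0 hpos, htot, totalPhase]
    rw [hcast] at hm0 hp0 ⊢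
    linarith [hm0.2, hp0.2]
  have hupper : r k < (k + 1) * (Real.pi / 2) := by
    have hs2 : 0 < ((k : ℝ) + 1) * (Real.pi / 2) := by positivity
    obtain ⟨hm2, hp2⟩ := hphase ((k + 1) * (Real.pi / 2)) (by rw [hcast]; linarith)
    rw [← hmono.lt_iff_lt hpos hs2, htot, totalPhase]
    linarith [hm2.1, hp2.1]
  refine ⟨fun ψ hψ => ?_, hlower, hupper⟩
  obtain ⟨-, A, hA, hu⟩ := hψ.eq_sin hm hp hpos
  obtain ⟨hm1, hp1⟩ := hphase _ hlower.le
  rw [totalPhase] at htot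
  -- The angle at the right end is `(k + 1) * π - phase⁺`.
  exact mem_S hψ.1 hpos hA hu hm1 ⟨by linarith [hp1.2], by linarith [hp1.1]⟩

end Main

end MultiPoint

end

theorem mainTheorem2 (cm cp : MultiPoint.EndCondition)
    (hm : cm.Standing (-1)) (hp : cp.Standing 1)
    (hm1 : cm.LinCond) (hp1 : cp.LinCond) :
    ∃ lam lamN lamD : ℕ → ℝ,
      MultiPoint.Enumerates lam (MultiPoint.eigenvalues (MultiPoint.MultiPointBC cm cp)) ∧
      MultiPoint.Enumerates lamN (MultiPoint.eigenvalues MultiPoint.Neumann) ∧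
      MultiPoint.Enumerates lamD (MultiPoint.eigenvalues MultiPoint.Dirichlet) ∧
      ∀ k : ℕ,
        ((k : ℕ∞) + 2 ≤ MultiPoint.kT cm cp lamN →
          (∀ ψ : ℝ → ℝ,
            MultiPoint.IsEigenfunction (MultiPoint.MultiPointBC cm cp) (lam k) ψ →
              ψ ∈ MultiPoint.T (k + 1)) ∧
          lamN k < lam k ∧ lam k < lamN (k + 2)) ∧
        (MultiPoint.kS cm cp lamD + 2 ≤ (k : ℕ∞) →
          (∀ ψ : ℝ → ℝ,
            MultiPoint.IsEigenfunction (MultiPoint.MultiPointBC cm cp) (lam k) ψ →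
              ψ ∈ MultiPoint.S k) ∧
          lamD (k - 2) < lam k ∧ lam k < lamD k) := by
  obtain ⟨a, b, hm⟩ := hm.exists_small (Or.inl rfl) hm1
  obtain ⟨a', b', hp⟩ := hp.exists_small (Or.inr rfl) hp1
  obtain ⟨r, hr⟩ := MultiPoint.exists_isRootSequence hm hp
  refine ⟨_, _, _, hr.enumerates, MultiPoint.enumerates_neumann,
    MultiPoint.enumerates_dirichlet, fun k => ⟨fun hk => ?_, fun hk => ?_⟩⟩
  · obtain ⟨h1, h2, h3⟩ := hr.low hm hp
      (MultiPoint.le_min_J_of_le_kT MultiPoint.enumerates_neumann.1 hk)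
    exact ⟨h1, pow_lt_pow_left₀ h2 (by positivity) two_ne_zero,
      pow_lt_pow_left₀ h3 (hr.nonneg k) two_ne_zero⟩
  · obtain ⟨hk2, hJ⟩ := MultiPoint.max_J_le_of_kS_le MultiPoint.enumerates_dirichlet.1 hk
    obtain ⟨h1, h2, h3⟩ := hr.high hm hp hk2 hJ
    exact ⟨h1, pow_lt_pow_left₀ h2 (by positivity) two_ne_zero,
      pow_lt_pow_left₀ h3 (hr.nonneg k) two_ne_zero⟩
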